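/- **Setting.** Consider $\min f(x)$ subject to $h(x)=0$, $c(x)\le 0$, with $f:\mathbb R^n\to\mathbb R$, $h:\mathbb R^n\to\mathbb R^{m_1}$, $c:\mathbb R^n\to\mathbb R^{m_2}$ continuously differentiable; $\|\cdot\|$ is the Euclidean norm. Let $K_0=\{0\}\times\mathbb R_-^{m_2}$ and $$\phi(x)=\mathrm{dist}_\infty\big((h(x),c(x))\mid K_0\big),\qquad \Psi(x;\rho)=f(x)+\rho\,\phi(x),$$ $$\kappa(x,\sigma)=\inf_{\|p\|_\infty\le\sigma}\mathrm{dist}_\infty\big((h(x)+\nabla h(x)^Tp,\;c(x)+\nabla c(x)^Tp)\mid K_0\big),\qquad \Delta_\phi(x,\sigma)=\phi(x)-\kappa(x,\sigma),$$ $$\chi(x)=-\min\{\nabla f(x)^Tt:\ \nabla h(x)^Tt=0,\ \nabla c(x)^Tt\le0,\ \|t\|_\infty\le\tfrac12\beta_l\}.$$ **Algorithm.** Parameters: $0<2\sigma_u<\beta_l<\beta_u$, $\kappa_u>0$, $\gamma>1$, $\theta\in(0,1)$, $\alpha_{\max}>0$, $\alpha_0=\gamma^{-j_0}\alpha_{\max}$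 with an integer $j_0\geq 1$, $\zeta_0,\zeta_c>0$, $\rho_0>0$, $p_0^g$, and an increasing sequence $a_j\in(0,1]$ with $a_0\ge p_0^g$ and $\sum_j(1-a_j)<\infty$. At iteration $k$, with $\sigma_k=\min\{\sigma_u,\kappa_u\phi(x_k)\}$, $\kappa_k=\kappa(x_k,\sigma_k)$, some $\beta_k\in[\beta_l,\beta_u]$, a matrix $H_k$ and a random estimate $g_k$ of $\nabla f(x_k)$, let $d_k$ minimize $g_k^Td+\frac12d^TH_kd$ subject to $-\kappa_ke\le h(x_k)+\nabla h(x_k)^Td\le\kappa_ke$, $c(x_k)+\nabla c(x_k)^Td\le\kappa_ke$, $\|d\|_\infty\le\beta_k$. If $\|g_k\|>\zeta_k$, set $\zeta_{k+1}=\max\{\zeta_k+\zeta_c,\|g_k\|\}$ and let $p^g_{k+1}$ be the next $a_j$ (starting with $a_1$); otherwise keep $\zeta_k$ and $p^g_k$. Put $\Delta_k(\rho)=-g_k^Td_k+\rho\,\Delta_\phi(x_k,\sigma_k)$. If $\Delta_k(\rho_k)\ge\frac12d_k^TH_kd_k$ then $\rho_{k+1}=\rho_k$, otherwise $\rho_{k+1}=\max\{(g_k^Td_k+\frac12d_k^TH_kd_k)/\Delta_\phi(x_k,\sigma_k),\,2\rho_k\}$.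 With random estimates $f_k^0$ of $f(x_k)$ and $f_k^s$ of $f(x_k+\alpha_kd_k)$, the step is successful if $$f_k^0+\rho_{k+1}\phi(x_k)-f_k^s-\rho_{k+1}\phi(x_k+\alpha_kd_k)\ge\theta\alpha_k\Delta_k(\rho_{k+1});$$ then $x_{k+1}=x_k+\alpha_kd_k$ and $\alpha_{k+1}=\min\{\gamma\alpha_k,\alpha_{\max}\}$. Otherwise $x_{k+1}=x_k$ and $\alpha_{k+1}=\gamma^{-1}\alpha_k$. Let $\mathcal F_{k-1}$ be the $\sigma$-algebra generated by $g_i,f_i^0,f_i^s$ $(i<k)$, and $\mathcal F_{k-1/2}$ the one generated by $\mathcal F_{k-1}$ and $g_k$; $d_k$ is $\mathcal F_{k-1/2}$-measurable. **Assumptions.** 1. A bounded closed set $\Omega$ contains all iterates $x_k$ and trial points $x_k+\alpha d_k$, $0\le\alpha\le\alpha_k$. On $\Omega$ the gradients $\nabla f,\nabla h_i,\nabla c_i$ are Lipschitz with constants $L_f,L_{h,i},L_{c,i}$; $L_{hc}$ is the maximum of the $L_{h,i}$ and $L_{c,i}$. For constants $\xi,M_H>0$, $2\xi\|d\|^2\le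 d^TH_kd\le M_H\|d\|^2$ for all $d$ and $k$. 2. $\Pr(\|g_k-\nabla f(x_k)\|\le\kappa_g\alpha_k\|d_k\|\mid\mathcal F_{k-1})\ge p_k^g$ and $\Pr(|f_k^0-f(x_k)|\le\varepsilon_f\alpha_k^2\|d_k\|^2,\ |f_k^s-f(x_k+\alpha_kd_k)|\le\varepsilon_f\alpha_k^2\|d_k\|^2\mid\mathcal F_{k-1/2})\ge p_f$, where $\kappa_g>0$ and $0<\varepsilon_f<\frac{\xi\theta}{4\alpha_{\max}}$. 3. The extended MFCQ holds at every point $x$ of a closed set $K\subseteq\Omega$ that contains all iterates (for instance the closure of the set of all iterates): the $\nabla h_i(x)$ are linearly independent, and there is $z$ with $\nabla h(x)^Tz=0$ and $\nabla c_i(x)^Tz<0$ whenever $c_i(x)\ge0$. 4. $\mathbf E[|f_k^s-f(x_k+\alpha_kd_k)|^2\mid\mathcal F_{k-1/2}]$ and $\mathbf E[|f_k^0-f(x_k)|^2\mid\mathcal F_{k-1/2}]$ are at most $\kappa_f^2\alpha_k^2(\phi(x_k)^2+\chi(x_k)^2)^2$, where $\kappa_f>0$. 5. (Bounded regime.) $\zeta_k=\zeta_0$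 and $p_k^g=p_g$ for all $k$ (in particular $\|g_k\|\le\zeta_0$), and the penalty parameter starts at $\rho_0=\bar\rho$. **Theorem.** There is $\rho_*>0$ such that for every $\bar\rho>\rho_*$ there is $\nu_*\in(0,1)$ such that the following holds for every $\nu\in[\nu_*,1)$; here $\rho_*$ and $\nu_*$ depend only on the problem, $\Omega$, $K$, the Lipschitz constants, the algorithm parameters $\sigma_u,\kappa_u,\beta_l,\beta_u,\gamma,\theta,\alpha_{\max},j_0,\zeta_0,\zeta_c$ and $\xi,M_H,\kappa_g,\varepsilon_f$, and $\nu_*$ also on $\bar\rho$. Let $p_f,p_g\in(0,1]$ satisfy $$p_g\ge\frac{2\gamma-1}{2\gamma-\frac12\gamma^{-1}-\frac12},\qquad \frac{p_f}{\sqrt{1-p_f}}\ge\frac{8\big((1-\nu)(\gamma-1)+2\nu\kappa_f\big)}{p_g(1-\gamma^{-1})(1-\nu)},\qquad p_fp_g\ge\tfrac12$$ (the second one being satisfied if $p_f=1$). Let $\Psi_{\min}\le\Psi(x;\bar\rho)$ for all $x\in\Omega$, put $\Phi_0=\nu(\Psi(x_0;\bar\rho)-\Psi_{\min})+(1-\nu)\alpha_0(\phi(x_0)^2+\chi(x_0)^2)$,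 let $\varepsilon>0$ and $T_\varepsilon=\inf\{k\ge0:\phi(x_k)^2+\chi(x_k)^2<\varepsilon\}$. Then, for every process generated by the algorithm under the assumptions above, $$\mathbf E[T_\varepsilon]\le\frac1{2p_fp_g-1}\cdot\frac{4\left(\kappa_g\beta_u+\frac12L_f+2\varepsilon_f+\frac12\bar\rho L_{hc}\right)}{(1-\nu)(1-\gamma^{-1})(1-\theta)\,\xi\,\varepsilon}\,\Phi_0+1 .$$ -/

import Mathlib

open MeasureTheory

noncomputable section

namespace StochSQP

/-- `ℝⁿ` with the Euclidean norm. -/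
abbrev E (n : ℕ) : Type := EuclideanSpace ℝ (Fin n)

/-- The `ℓ∞` norm of a vector of `ℝⁿ`. -/
def supNorm {n : ℕ} (v : E n) : ℝ := ‖WithLp.ofLp v‖

/-- The quadratic form `dᵀ H d`. -/
def quad {n : ℕ} (H : Matrix (Fin n) (Fin n) ℝ) (d : E n) : ℝ :=
  WithLp.ofLp d ⬝ᵥ H.mulVec (WithLp.ofLp d)

/-- The cone `{0} × ℝ₋^{m₂}`, in a product that carries the `ℓ∞` metric. -/
def cone (m₁ m₂ : ℕ) : Set ((Fin m₁ → ℝ) × (Fin m₂ → ℝ)) :=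
  {w | w.1 = 0 ∧ ∀ i, w.2 i ≤ 0}

/-- The problem `min f(x)` subject to `h(x) = 0`, `c(x) ≤ 0` on `ℝⁿ`. -/
structure Problem (n m₁ m₂ : ℕ) where
  f : E n → ℝ
  h : Fin m₁ → E n → ℝ
  c : Fin m₂ → E n → ℝ

namespace Problem

variable {n m₁ m₂ : ℕ} (Q : Problem n m₁ m₂)

/-- Infeasibility: `φ(x) = dist_∞ ((h(x), c(x)) | {0} × ℝ₋)`. -/
def phi (x : E n) : ℝ :=
  Metric.infDist ((fun i => Q.h i x, fun i => Q.c i x) : (Fin m₁ → ℝ) × (Fin m₂ → ℝ))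
    (cone m₁ m₂)

/-- Infeasibility of the constraints linearized at `x`, for the displacement `p`. -/
def linPhi (x p : E n) : ℝ :=
  Metric.infDist
    ((fun i => Q.h i x + inner ℝ (gradient (Q.h i) x) p,
      fun i => Q.c i x + inner ℝ (gradient (Q.c i) x) p) : (Fin m₁ → ℝ) × (Fin m₂ → ℝ))
    (cone m₁ m₂)

/-- `κ(x, σ)`: least linearized infeasibility over `‖p‖_∞ ≤ σ` (used with `σ ≥ 0`). -/
def kap (x : E n) (σ : ℝ) : ℝ := sInf (Q.linPhi x '' {p | supNorm p ≤ σ})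

/-- `Δ_φ(x, σ) = φ(x) - κ(x, σ)`. -/
def deltaPhi (x : E n) (σ : ℝ) : ℝ := Q.phi x - Q.kap x σ

/-- The exact penalty function `Ψ(x; ρ) = f(x) + ρ φ(x)`. -/
def Psi (ρ : ℝ) (x : E n) : ℝ := Q.f x + ρ * Q.phi x

/-- Feasible set of the linear program that defines `χ`. -/
def chiFeasible (βl : ℝ) (x : E n) : Set (E n) :=
  {t | (∀ i, inner ℝ (gradient (Q.h i) x) t = 0) ∧
       (∀ i, inner ℝ (gradient (Q.c i) x) t ≤ 0) ∧ supNorm t ≤ βl / 2}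

/-- Optimality measure: `χ(x) = - min {∇f(x)ᵀ t : t feasible}`. -/
def chi (βl : ℝ) (x : E n) : ℝ :=
  - sInf ((fun t => inner ℝ (gradient Q.f x) t) '' Q.chiFeasible βl x)

/-- The extended Mangasarian–Fromovitz constraint qualification at `x`. -/
def EMFCQ (x : E n) : Prop :=
  LinearIndependent ℝ (fun i => gradient (Q.h i) x) ∧
  ∃ z : E n, (∀ i, inner ℝ (gradient (Q.h i) x) z = 0) ∧
    ∀ i, 0 ≤ Q.c i x → inner ℝ (gradient (Q.c i) x) z < 0

/-- Regularity of the data on the set `Ω`: it is bounded and closed, the functions are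
continuously differentiable, and their gradients are Lipschitz continuous on `Ω`.
(All boundedness requirements on the functions and gradients follow by compactness.) -/
structure RegularOn (Ω : Set (E n)) (Lf : NNReal) (Lh : Fin m₁ → NNReal)
    (Lc : Fin m₂ → NNReal) : Prop where
  bounded : Bornology.IsBounded Ω
  closed : IsClosed Ω
  smooth_f : ContDiff ℝ 1 Q.f
  smooth_h : ∀ i, ContDiff ℝ 1 (Q.h i)
  smooth_c : ∀ i, ContDiff ℝ 1 (Q.c i)
  lip_f : LipschitzOnWith Lf (gradient Q.f) Ω
  lip_h : ∀ i, LipschitzOnWith (Lh i) (gradient (Q.h i)) Ω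
  lip_c : ∀ i, LipschitzOnWith (Lc i) (gradient (Q.c i)) Ω

/-- Feasible set of the direction-finding quadratic program at `x`. -/
def qpFeasible (x : E n) (κ β : ℝ) : Set (E n) :=
  {d | (∀ i, -κ ≤ Q.h i x + inner ℝ (gradient (Q.h i) x) d ∧
             Q.h i x + inner ℝ (gradient (Q.h i) x) d ≤ κ) ∧
       (∀ i, Q.c i x + inner ℝ (gradient (Q.c i) x) d ≤ κ) ∧ supNorm d ≤ β}

end Problem

/-- `L_hc`, the maximum of the Lipschitz constants of all the constraint gradients. -/
def Lhc {m₁ m₂ : ℕ} (Lh : Fin m₁ → NNReal) (Lc : Fin m₂ → NNReal) : ℝ :=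
  ((max (Finset.univ.sup Lh) (Finset.univ.sup Lc) : NNReal) : ℝ)

/-- Parameters of the stochastic SQP algorithm. -/
structure Params where
  σu : ℝ
  κu : ℝ
  βl : ℝ
  βu : ℝ
  γ : ℝ
  θ : ℝ
  αmax : ℝ
  /-- `α₀ = γ^{-j₀} α_max` -/
  j₀ : ℕ
  ζ₀ : ℝ
  ζc : ℝ
  σu_pos : 0 < σu
  κu_pos : 0 < κu
  βl_gt : 2 * σu < βl
  βu_gt : βl < βu
  γ_gt : 1 < γ
  θ_pos : 0 < θ
  θ_lt : θ < 1
  αmax_pos : 0 < αmax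
  j₀_pos : 0 < j₀
  ζ₀_pos : 0 < ζ₀
  ζc_pos : 0 < ζc

/-- The initial step size. -/
def Params.α₀ (A : Params) : ℝ := A.αmax / A.γ ^ A.j₀

/-- The trust radius `σ(x) = min {σ_u, κ_u φ(x)}`. -/
def Params.sigma {n m₁ m₂ : ℕ} (A : Params) (Q : Problem n m₁ m₂) (x : E n) : ℝ :=
  min A.σu (A.κu * Q.phi x)

/-- A random process generated by the stochastic SQP algorithm on the sample space `S`,
from the starting point `x₀`, with initial penalty parameter `ρ₀` and initial gradient
accuracy probability `p₀`.  The gradient estimates `g`, the function estimates `f0`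
(at `x_k`) and `fs` (at the trial point), the Hessian models `H` and the radii `β` are
free; the other quantities are determined by the algorithm.  The multiplier estimates
do not influence the iteration and are not recorded. -/
structure Run {n m₁ m₂ : ℕ} (Q : Problem n m₁ m₂) (A : Params) (x₀ : E n) (ρ₀ p₀ : ℝ)
    (S : Type*) [MeasurableSpace S] where
  x : ℕ → S → E n
  α : ℕ → S → ℝ
  ρ : ℕ → S → ℝ
  g : ℕ → S → E n
  d : ℕ → S → E n
  f0 : ℕ → S → ℝ
  fs : ℕ → S → ℝ
  H : ℕ → S → Matrix (Fin n) (Fin n) ℝ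
  β : ℕ → S → ℝ
  /-- threshold for the size of the gradient estimates -/
  ζ : ℕ → S → ℝ
  /-- required accuracy probability of the gradient estimates -/
  pg : ℕ → S → ℝ
  /-- counter of the threshold updates -/
  j : ℕ → S → ℕ
  /-- the preset sequence of accuracy probabilities -/
  a : ℕ → ℝ
  a_mono : Monotone a
  a_pos : ∀ i, 0 < a i
  a_le : ∀ i, a i ≤ 1
  a_zero : p₀ ≤ a 0
  a_sum : Summable fun i => 1 - a i
  meas_g : ∀ k, Measurable (g k)
  meas_f0 : ∀ k, Measurable (f0 k)
  meas_fs : ∀ k, Measurable (fs k)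
  x_zero : ∀ ω, x 0 ω = x₀
  α_zero : ∀ ω, α 0 ω = A.α₀
  ρ_zero : ∀ ω, ρ 0 ω = ρ₀
  ζ_zero : ∀ ω, ζ 0 ω = A.ζ₀
  pg_zero : ∀ ω, pg 0 ω = p₀
  j_zero : ∀ ω, j 0 ω = 1
  β_mem : ∀ k ω, β k ω ∈ Set.Icc A.βl A.βu
  /-- `d_k` is feasible for the quadratic program with the estimated gradient … -/
  d_mem : ∀ k ω, d k ω ∈
    Q.qpFeasible (x k ω) (Q.kap (x k ω) (A.sigma Q (x k ω))) (β k ω)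
  /-- … and minimizes its objective. -/
  d_min : ∀ k ω, IsMinOn (fun v => inner ℝ (g k ω) v + 1 / 2 * quad (H k ω) v)
    (Q.qpFeasible (x k ω) (Q.kap (x k ω) (A.sigma Q (x k ω))) (β k ω)) (d k ω)
  /-- update of the threshold and of the accuracy probability -/
  ζ_large : ∀ k ω, ζ k ω < ‖g k ω‖ →
    ζ (k + 1) ω = max (ζ k ω + A.ζc) ‖g k ω‖ ∧ pg (k + 1) ω = a (j k ω) ∧
      j (k + 1) ω = j k ω + 1
  ζ_small : ∀ k ω, ‖g k ω‖ ≤ ζ k ω →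
    ζ (k + 1) ω = ζ k ω ∧ pg (k + 1) ω = pg k ω ∧ j (k + 1) ω = j k ω
  /-- update of the penalty parameter -/
  ρ_keep : ∀ k ω,
    1 / 2 * quad (H k ω) (d k ω) ≤
      -inner ℝ (g k ω) (d k ω) + ρ k ω * Q.deltaPhi (x k ω) (A.sigma Q (x k ω)) →
    ρ (k + 1) ω = ρ k ω
  ρ_increase : ∀ k ω,
    ¬ (1 / 2 * quad (H k ω) (d k ω) ≤
      -inner ℝ (g k ω) (d k ω) + ρ k ω * Q.deltaPhi (x k ω) (A.sigma Q (x k ω))) →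
    ρ (k + 1) ω =
      max ((inner ℝ (g k ω) (d k ω) + 1 / 2 * quad (H k ω) (d k ω)) /
            Q.deltaPhi (x k ω) (A.sigma Q (x k ω)))
          (2 * ρ k ω)
  /-- line search: successful step -/
  step_success : ∀ k ω,
    A.θ * α k ω * (-inner ℝ (g k ω) (d k ω)
        + ρ (k + 1) ω * Q.deltaPhi (x k ω) (A.sigma Q (x k ω))) ≤
      (f0 k ω + ρ (k + 1) ω * Q.phi (x k ω))
        - (fs k ω + ρ (k + 1) ω * Q.phi (x k ω + α k ω • d k ω)) →
    x (k + 1) ω = x k ω + α k ω • d k ω ∧ α (k + 1) ω = min (A.γ * α k ω) A.αmax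
  /-- line search: unsuccessful step -/
  step_fail : ∀ k ω,
    ¬ (A.θ * α k ω * (-inner ℝ (g k ω) (d k ω)
        + ρ (k + 1) ω * Q.deltaPhi (x k ω) (A.sigma Q (x k ω))) ≤
      (f0 k ω + ρ (k + 1) ω * Q.phi (x k ω))
        - (fs k ω + ρ (k + 1) ω * Q.phi (x k ω + α k ω • d k ω))) →
    x (k + 1) ω = x k ω ∧ α (k + 1) ω = A.γ⁻¹ * α k ω

namespace Run

variable {n m₁ m₂ : ℕ} {Q : Problem n m₁ m₂} {A : Params} {x₀ : E n} {ρ₀ p₀ : ℝ}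
  {S : Type*} [MeasurableSpace S] (R : Run Q A x₀ ρ₀ p₀ S)

/-- `𝓕_{k-1}`: generated by the estimates `g_i, f0_i, fs_i` with `i < k`. -/
def past (k : ℕ) : MeasurableSpace S :=
  ⨆ i : Fin k, MeasurableSpace.comap (R.g i) inferInstance ⊔
    MeasurableSpace.comap (R.f0 i) inferInstance ⊔ MeasurableSpace.comap (R.fs i) inferInstance

/-- `𝓕_{k-1/2}`: generated by `𝓕_{k-1}` and `g_k`. -/
def pastHalf (k : ℕ) : MeasurableSpace S :=
  R.past k ⊔ MeasurableSpace.comap (R.g k) inferInstance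

/-- The search direction is a random vector computed from the history and `g_k`. -/
def Adapted : Prop := ∀ k, Measurable[R.pastHalf k] (R.d k)

/-- The iterates lie in `K`, and the trial points `x_k + t d_k`, `0 ≤ t ≤ α_k`, in `Ω`. -/
def StaysIn (K Ω : Set (E n)) : Prop :=
  (∀ k ω, R.x k ω ∈ K) ∧
  ∀ k ω, ∀ t ∈ Set.Icc (0 : ℝ) (R.α k ω), R.x k ω + t • R.d k ω ∈ Ω

/-- `2 ξ ‖v‖² ≤ vᵀ H_k v ≤ M_H ‖v‖²` for all `v` and `k`. -/
def HessianBounds (ξ MH : ℝ) : Prop :=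
  ∀ k ω v, 2 * ξ * ‖v‖ ^ 2 ≤ quad (R.H k ω) v ∧ quad (R.H k ω) v ≤ MH * ‖v‖ ^ 2

/-- The event `I_k` that the gradient estimate is `κ_g`-sufficiently accurate. -/
def gradEvent (κg : ℝ) (k : ℕ) : Set S :=
  {ω | ‖R.g k ω - gradient Q.f (R.x k ω)‖ ≤ κg * R.α k ω * ‖R.d k ω‖}

/-- The event `J_k` that the function estimates are `ε_f`-sufficiently accurate. -/
def funEvent (εf : ℝ) (k : ℕ) : Set S :=
  {ω | |R.f0 k ω - Q.f (R.x k ω)| ≤ εf * R.α k ω ^ 2 * ‖R.d k ω‖ ^ 2 ∧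
       |R.fs k ω - Q.f (R.x k ω + R.α k ω • R.d k ω)|
          ≤ εf * R.α k ω ^ 2 * ‖R.d k ω‖ ^ 2}

/-- `Pr(I_k | 𝓕_{k-1}) ≥ p_k^g`. -/
def GradAccurate (μ : Measure S) (κg : ℝ) : Prop :=
  ∀ k, ∀ᵐ ω ∂μ,
    R.pg k ω ≤ (μ[(R.gradEvent κg k).indicator (fun _ => (1 : ℝ)) | R.past k]) ω

/-- `Pr(J_k | 𝓕_{k-1/2}) ≥ p_f`. -/
def FunAccurate (μ : Measure S) (εf pf : ℝ) : Prop :=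
  ∀ k, ∀ᵐ ω ∂μ,
    pf ≤ (μ[(R.funEvent εf k).indicator (fun _ => (1 : ℝ)) | R.pastHalf k]) ω

/-- The `κ_f`-variance condition on the function estimates. -/
def VarianceCond (μ : Measure S) (κf : ℝ) : Prop :=
  ∀ k,
    (MemLp (fun ω => R.fs k ω - Q.f (R.x k ω + R.α k ω • R.d k ω)) 2 μ ∧
      ∀ᵐ ω ∂μ,
        (μ[fun ω => |R.fs k ω - Q.f (R.x k ω + R.α k ω • R.d k ω)| ^ 2 | R.pastHalf k]) ω
          ≤ κf ^ 2 * R.α k ω ^ 2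
              * (Q.phi (R.x k ω) ^ 2 + Q.chi A.βl (R.x k ω) ^ 2) ^ 2) ∧
    (MemLp (fun ω => R.f0 k ω - Q.f (R.x k ω)) 2 μ ∧
      ∀ᵐ ω ∂μ,
        (μ[fun ω => |R.f0 k ω - Q.f (R.x k ω)| ^ 2 | R.pastHalf k]) ω
          ≤ κf ^ 2 * R.α k ω ^ 2
              * (Q.phi (R.x k ω) ^ 2 + Q.chi A.βl (R.x k ω) ^ 2) ^ 2)

/-- `T_ε = inf {k : φ(x_k)² + χ(x_k)² < ε}`, equal to `∞` if there is no such `k`. -/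
def hitTime (ε : ℝ) (ω : S) : ENNReal :=
  ⨅ (k : ℕ) (_ : Q.phi (R.x k ω) ^ 2 + Q.chi A.βl (R.x k ω) ^ 2 < ε), (k : ENNReal)

end Run

/-- The initial value `Φ₀` of the random merit function
`Φ_k = ν (Ψ(x_k; ρ̄) - Ψ_min) + (1 - ν) α_k (φ(x_k)² + χ(x_k)²)`. -/
def merit₀ {n m₁ m₂ : ℕ} (Q : Problem n m₁ m₂) (A : Params) (x₀ : E n)
    (ρbar ν Ψmin : ℝ) : ℝ :=
  ν * (Q.Psi ρbar x₀ - Ψmin) + (1 - ν) * A.α₀ * (Q.phi x₀ ^ 2 + Q.chi A.βl x₀ ^ 2)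

end StochSQP

end

/-! ### Infeasibility, its linearization, and norms on `ℝⁿ`. -/

namespace StochSQP

/-! Under the extended MFCQ on the compact set `K`, a fixed fraction of the infeasibility can be
removed to first order inside the trust radius (`exists_deltaPhi_ge`). Comparing `d_k` with explicit
feasible points of its quadratic program then yields two facts. For `ρbar` above a threshold the
penalty parameter is never updated (`exists_penalty`). If the gradient estimate is accurate, `e_k =
φ(x_k)² + χ(x_k)²` is at most `Ce ‖d_k‖²` (`exists_sq_add_sq_le`).

Put `u_k = Ψ(x_k; ρbar) - Ψmin` and write `α_k = αmax / γ ^ i_k` with an integer level `i_k`. When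
all estimates are accurate, a successful step lowers `u` by at least `c α_k e_k`, and success is
certain once `i_k ≥ m`. This is abstracted in `LevelProcess`, where the good event has conditional
probability at least `p = pf pg ≥ 3/4`.

No bound is available on how `e` changes along a step, so `e` cannot be added to a Lyapunov
function. It is subtracted instead: `u + ε v (i - m)⁺ - w(i) e`, with `w(i) = v 4 ^ i` for `i ≤ m`
and `w(i) = 0` beyond. Whatever `e` becomes after a step then only helps. A failed step at a level
below `m` keeps `e` and multiplies its weight by four, so it too counts as progress. The price is
that nonnegativity is no longer obvious. It holds almost surely (`mul_le_merit`): if `u` were too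
small against `e` at a coarse level, good events would drive `u` below zero with positive
probability. The expected drift is at most `-v ε / 2` before the hitting time (`drift_le`), whence
`E[T_ε] ≤ 2 u_0 / (v ε)`.

Inaccurate function estimates may raise `u`. The variance condition bounds the conditional mean of
this increase by a multiple of `κf √(1 - pf) α e`, or by any larger prescribed multiple
(`setIntegral_compl_abs_le`).

Finally, `m`, `c` and `v` are fixed before `ν`. The condition on `pf` forces `κf √(1 - pf)` to be of
order `1 - ν`, and the asserted bound carries the factor `1 / (1 - ν)`. For `ν` close to one the
error is therefore small against `v`, and the asserted bound exceeds `2 u_0 / (v ε)`. Its explicit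
constants are absorbed in the choice of `νstar`, so sharp Taylor constants are not needed. -/

theorem infDist_cone_le_iff {m₁ m₂ : ℕ} (w : (Fin m₁ → ℝ) × (Fin m₂ → ℝ)) {r : ℝ} (hr : 0 ≤ r) :
    Metric.infDist w (cone m₁ m₂) ≤ r ↔ (∀ i, |w.1 i| ≤ r) ∧ ∀ i, w.2 i ≤ r := by
  have hne : (cone m₁ m₂).Nonempty := ⟨0, by simp [cone]⟩
  constructor
  · intro h
    have key : ∀ s, r < s → (∀ i, |w.1 i| ≤ s) ∧ ∀ i, w.2 i ≤ s := by
      intro s hs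
      obtain ⟨y, hy, hd⟩ := (Metric.infDist_lt_iff hne).1 (h.trans_lt hs)
      rw [Prod.dist_eq, max_lt_iff] at hd
      constructor
      · intro i
        have := (dist_le_pi_dist w.1 y.1 i).trans hd.1.le
        rw [hy.1] at this
        simpa [Real.dist_eq] using this
      · intro i
        have := (dist_le_pi_dist w.2 y.2 i).trans hd.2.le
        rw [Real.dist_eq] at this
        linarith [le_abs_self (w.2 i - y.2 i), hy.2 i]
    exact ⟨fun i => le_of_forall_gt_imp_ge_of_dense fun s hs => (key s hs).1 i,
      fun i => le_of_forall_gt_imp_ge_of_dense fun s hs => (key s hs).2 i⟩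
  · rintro ⟨h1, h2⟩
    have hy : ((0, fun i => min (w.2 i) 0) : (Fin m₁ → ℝ) × (Fin m₂ → ℝ)) ∈ cone m₁ m₂ :=
      ⟨rfl, fun i => min_le_right _ _⟩
    refine (Metric.infDist_le_dist_of_mem hy).trans ?_
    rw [Prod.dist_eq]
    refine max_le ((dist_pi_le_iff hr).2 fun i => ?_) ((dist_pi_le_iff hr).2 fun i => ?_)
    · simpa [Real.dist_eq] using h1 i
    · rw [Real.dist_eq]
      rcases le_total (w.2 i) 0 with h | h
      · simpa [min_eq_left h] using hr
      · simpa [min_eq_right h, abs_of_nonneg h] using h2 i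

theorem continuous_gradient {n : ℕ} {f : E n → ℝ} (hf : ContDiff ℝ 1 f) :
    Continuous (gradient f) :=
  (InnerProductSpace.toDual ℝ (E n)).symm.continuous.comp (hf.continuous_fderiv (by norm_num))

theorem continuous_supNorm {n : ℕ} : Continuous (supNorm : E n → ℝ) :=
  continuous_norm.comp (PiLp.continuous_ofLp 2 _)

theorem supNorm_nonneg {n : ℕ} (v : E n) : 0 ≤ supNorm v := norm_nonneg _

theorem supNorm_zero {n : ℕ} : supNorm (0 : E n) = 0 := by simp [supNorm]

theorem supNorm_smul {n : ℕ} (t : ℝ) (v : E n) : supNorm (t • v) = |t| * supNorm v := by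
  simp [supNorm, norm_smul]

theorem supNorm_add_le {n : ℕ} (v w : E n) : supNorm (v + w) ≤ supNorm v + supNorm w := by
  simpa [supNorm] using norm_add_le (WithLp.ofLp v) (WithLp.ofLp w)

theorem supNorm_le_norm {n : ℕ} (v : E n) : supNorm v ≤ ‖v‖ :=
  (pi_norm_le_iff_of_nonneg (norm_nonneg _)).2 fun i => PiLp.norm_apply_le v i

theorem norm_le_supNorm {n : ℕ} (v : E n) : ‖v‖ ≤ Real.sqrt n * supNorm v := by
  rw [EuclideanSpace.norm_eq]
  have h : ∑ i, ‖v i‖ ^ 2 ≤ n * supNorm v ^ 2 := by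
    calc ∑ i, ‖v i‖ ^ 2 ≤ ∑ _i : Fin n, supNorm v ^ 2 := by
          gcongr with i
          exact norm_le_pi_norm (WithLp.ofLp v) i
      _ = n * supNorm v ^ 2 := by simp
  refine (Real.sqrt_le_sqrt h).trans_eq ?_
  rw [Real.sqrt_mul (by positivity), Real.sqrt_sq (supNorm_nonneg v)]

theorem isCompact_supNorm_le {n : ℕ} (σ : ℝ) : IsCompact {p : E n | supNorm p ≤ σ} := by
  refine Metric.isCompact_of_isClosed_isBounded
    (isClosed_le continuous_supNorm continuous_const) ?_
  refine (Metric.isBounded_closedBall (x := (0 : E n)) (r := Real.sqrt n * σ)).subset fun p hp => ?_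
  rw [mem_closedBall_zero_iff]
  exact (norm_le_supNorm p).trans (mul_le_mul_of_nonneg_left hp (Real.sqrt_nonneg _))

namespace Problem

variable {n m₁ m₂ : ℕ} {Q : Problem n m₁ m₂}

theorem phi_nonneg (x : E n) : 0 ≤ Q.phi x := Metric.infDist_nonneg

theorem linPhi_nonneg (x p : E n) : 0 ≤ Q.linPhi x p := Metric.infDist_nonneg

theorem phi_le_iff (x : E n) {r : ℝ} (hr : 0 ≤ r) :
    Q.phi x ≤ r ↔ (∀ i, |Q.h i x| ≤ r) ∧ ∀ i, Q.c i x ≤ r :=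
  infDist_cone_le_iff _ hr

theorem linPhi_le_iff (x p : E n) {r : ℝ} (hr : 0 ≤ r) :
    Q.linPhi x p ≤ r ↔ (∀ i, |Q.h i x + inner ℝ (gradient (Q.h i) x) p| ≤ r) ∧
      ∀ i, Q.c i x + inner ℝ (gradient (Q.c i) x) p ≤ r :=
  infDist_cone_le_iff _ hr

theorem linPhi_zero (x : E n) : Q.linPhi x 0 = Q.phi x := by simp [linPhi, phi]

/-- Convexity along the segment from the zero displacement, where the value is `φ`. A step may thus
be shortened, to fit a trust radius or the line search, with a proportional loss of reduction. -/
theorem linPhi_smul_le (x p : E n) {t : ℝ} (h0 : 0 ≤ t) (h1 : t ≤ 1) :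
    Q.linPhi x (t • p) ≤ (1 - t) * Q.phi x + t * Q.linPhi x p := by
  have hφ := phi_nonneg (Q := Q) x
  have hl := linPhi_nonneg (Q := Q) x p
  have h1' : 0 ≤ 1 - t := by linarith
  obtain ⟨a1, a2⟩ := (phi_le_iff (Q := Q) x hφ).1 le_rfl
  obtain ⟨b1, b2⟩ := (linPhi_le_iff (Q := Q) x p hl).1 le_rfl
  rw [linPhi_le_iff x _ (by positivity)]
  constructor
  · intro i
    rw [inner_smul_right]
    have e : Q.h i x + t * inner ℝ (gradient (Q.h i) x) p
      = (1 - t) * Q.h i x + t * (Q.h i x + inner ℝ (gradient (Q.h i) x) p) := by ring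
    rw [e]
    refine (abs_add_le _ _).trans ?_
    rw [abs_mul, abs_mul, abs_of_nonneg h0, abs_of_nonneg h1']
    gcongr
    · exact a1 i
    · exact b1 i
  · intro i
    rw [inner_smul_right]
    have e : Q.c i x + t * inner ℝ (gradient (Q.c i) x) p
      = (1 - t) * Q.c i x + t * (Q.c i x + inner ℝ (gradient (Q.c i) x) p) := by ring
    rw [e]
    gcongr
    · exact a2 i
    · exact b2 i

theorem kap_le (x : E n) {σ : ℝ} {p : E n} (hp : supNorm p ≤ σ) : Q.kap x σ ≤ Q.linPhi x p :=
  csInf_le ⟨0, by rintro _ ⟨q, -, rfl⟩; exact linPhi_nonneg x q⟩ ⟨p, hp, rfl⟩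

theorem kap_nonneg (x : E n) (σ : ℝ) : 0 ≤ Q.kap x σ :=
  Real.sInf_nonneg (by rintro _ ⟨q, -, rfl⟩; exact linPhi_nonneg x q)

theorem continuous_linPhi_right (x : E n) : Continuous (Q.linPhi x) := by
  refine (Metric.continuous_infDist_pt _).comp (Continuous.prodMk ?_ ?_) <;>
  · refine continuous_pi fun i => ?_
    fun_prop

theorem exists_kap_eq (x : E n) {σ : ℝ} (hσ : 0 ≤ σ) :
    ∃ p, supNorm p ≤ σ ∧ Q.linPhi x p = Q.kap x σ := by
  have hne : {p : E n | supNorm p ≤ σ}.Nonempty := ⟨0, by simpa [supNorm_zero] using hσ⟩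
  obtain ⟨p, hp, hpmin⟩ := ((isCompact_supNorm_le σ).image (continuous_linPhi_right (Q := Q) x)).sInf_mem
    (hne.image _)
  exact ⟨p, hp, hpmin⟩

theorem mem_qpFeasible_iff (x d : E n) {κ β : ℝ} (hκ : 0 ≤ κ) :
    d ∈ Q.qpFeasible x κ β ↔ Q.linPhi x d ≤ κ ∧ supNorm d ≤ β := by
  rw [linPhi_le_iff x d hκ]
  simp only [qpFeasible, Set.mem_ofPred_eq, abs_le, and_assoc]

namespace RegularOn

variable {Ω : Set (E n)} {Lf : NNReal} {Lh : Fin m₁ → NNReal} {Lc : Fin m₂ → NNReal}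

theorem isCompact (hΩ : Q.RegularOn Ω Lf Lh Lc) : IsCompact Ω :=
  Metric.isCompact_of_isClosed_isBounded hΩ.closed hΩ.bounded

theorem continuous_phi (hΩ : Q.RegularOn Ω Lf Lh Lc) : Continuous Q.phi :=
  (Metric.continuous_infDist_pt _).comp (Continuous.prodMk
    (continuous_pi fun i => (hΩ.smooth_h i).continuous)
    (continuous_pi fun i => (hΩ.smooth_c i).continuous))

theorem continuous_linPhi (hΩ : Q.RegularOn Ω Lf Lh Lc) :
    Continuous fun y : E n × E n => Q.linPhi y.1 y.2 := by
  refine (Metric.continuous_infDist_pt _).comp (Continuous.prodMk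
    (continuous_pi fun i => ?_) (continuous_pi fun i => ?_))
  · exact ((hΩ.smooth_h i).continuous.comp continuous_fst).add
      (((continuous_gradient (hΩ.smooth_h i)).comp continuous_fst).inner continuous_snd)
  · exact ((hΩ.smooth_c i).continuous.comp continuous_fst).add
      (((continuous_gradient (hΩ.smooth_c i)).comp continuous_fst).inner continuous_snd)

end RegularOn

theorem sigma_nonneg (A : Params) (x : E n) : 0 ≤ A.sigma Q x :=
  le_min A.σu_pos.le (mul_nonneg A.κu_pos.le (phi_nonneg x))

end Problem

end StochSQP

/-! ### First-order reduction of infeasibility under the extended MFCQ. -/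

namespace StochSQP

open Filter Topology

/-- Projection along a compact factor is a closed map. Sublevel sets of optimal values are such
projections, which is how `κ` and `-χ` are shown to be measurable. -/
theorem isClosed_exists_mem_of_isCompact {X Y : Type*} [TopologicalSpace X] [TopologicalSpace Y]
    {k : Set Y} (hk : IsCompact k) {s : Set (X × Y)} (hs : IsClosed s) :
    IsClosed {x | ∃ y ∈ k, (x, y) ∈ s} := by
  have : CompactSpace k := isCompact_iff_compactSpace.1 hk
  have h := isClosedMap_fst_of_compactSpace (X := X) (Y := k) _
    (hs.preimage (f := fun q : X × k => (q.1, (q.2 : Y))) (by fun_prop))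
  convert h using 1
  ext x
  simp

/-- Linearly independent vectors have a dual system. -/
theorem exists_dual_system {n m : ℕ} {v : Fin m → E n} (hv : LinearIndependent ℝ v) :
    ∃ w : Fin m → E n, ∀ i j, inner ℝ (v i) (w j) = if i = j then 1 else 0 := by
  have h : ∀ j, ∃ w : E n, ∀ i, inner ℝ (v i) w = if i = j then 1 else 0 := by
    intro j
    -- The `j`-th coordinate on the span, extended to the whole space and represented by a vector.
    obtain ⟨l, hl⟩ := ((Finsupp.lapply j).comp hv.repr).exists_extend
    refine ⟨(InnerProductSpace.toDual ℝ (E n)).symm (LinearMap.toContinuousLinearMap l), fun i => ?_⟩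
    rw [real_inner_comm, InnerProductSpace.toDual_symm_apply]
    have hi : v i ∈ Submodule.span ℝ (Set.range v) := Submodule.subset_span ⟨i, rfl⟩
    have h1 := LinearMap.congr_fun hl ⟨v i, hi⟩
    simp only [LinearMap.comp_apply, Submodule.subtype_apply] at h1
    rw [LinearMap.coe_toContinuousLinearMap', h1, hv.repr_eq_single i _ rfl]
    simp [Finsupp.single_apply]
  choose w hw using h
  exact ⟨w, fun i j => hw j i⟩

namespace Problem

variable {n m₁ m₂ : ℕ} {Q : Problem n m₁ m₂}
  {Ω K : Set (E n)} {Lf : NNReal} {Lh : Fin m₁ → NNReal} {Lc : Fin m₂ → NNReal}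

/-- Under the extended MFCQ the linearized infeasibility can be reduced by a fixed fraction,
with a step of the order of the infeasibility, near the point. -/
theorem RegularOn.eventually_linPhi_le (hΩ : Q.RegularOn Ω Lf Lh Lc) {y : E n} (hy : Q.EMFCQ y) :
    ∃ D c : ℝ, 0 < D ∧ 0 < c ∧ c ≤ 1 ∧ ∀ᶠ x in 𝓝 y, ∃ p : E n,
      ‖p‖ ≤ D * Q.phi x ∧ Q.linPhi x p ≤ (1 - c) * Q.phi x := by
  obtain ⟨hli, z, hz1, hz2⟩ := hy
  obtain ⟨w, hw⟩ := exists_dual_system hli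
  set W : ℝ := ∑ j, ‖w j‖ with hW
  have hW0 : 0 ≤ W := Finset.sum_nonneg fun _ _ => norm_nonneg _
  -- Large enough that moving by `D₁ z` per unit of `φ` outweighs, in every constraint with `0 ≤
  -- c_i(y)`, the correction for the equalities (at most `W` per unit of `φ`) with a margin of one.
  -- The sum replaces a maximum.
  set D₁ : ℝ := ∑ i, (‖gradient (Q.c i) y‖ * W + 1) / |inner ℝ (gradient (Q.c i) y) z| with hD₁
  have hD₁0 : 0 ≤ D₁ := Finset.sum_nonneg fun _ _ => by positivity
  have hD₁i : ∀ i, 0 ≤ Q.c i y →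
      D₁ * inner ℝ (gradient (Q.c i) y) z ≤ -(‖gradient (Q.c i) y‖ * W + 1) := by
    intro i hi
    have hneg := hz2 i hi
    have h1 : (‖gradient (Q.c i) y‖ * W + 1) / |inner ℝ (gradient (Q.c i) y) z| ≤ D₁ :=
      Finset.single_le_sum
        (f := fun i => (‖gradient (Q.c i) y‖ * W + 1) / |inner ℝ (gradient (Q.c i) y) z|)
        (fun _ _ => by positivity) (Finset.mem_univ i)
    rw [abs_of_neg hneg, div_le_iff₀ (by linarith)] at h1
    linarith
  set D : ℝ := D₁ * ‖z‖ + W + 1 with hD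
  have hD1 : 1 ≤ D := by
    have : 0 ≤ D₁ * ‖z‖ := by positivity
    linarith
  have hDinv : 1 / (2 * D) ≤ 1 := by
    rw [div_le_one (by linarith)]; linarith
  have hDpos : 0 < 1 / (2 * D) := by positivity
  set F : ℝ := Q.phi y + 1 with hF
  -- Along `z` nothing is known about constraints inactive at `y`; the factor `t` keeps their
  -- first-order change within half of the slack.
  obtain ⟨t, ⟨ht1, htc⟩, ht0⟩ : ∃ t : ℝ, (t ≤ 1 ∧ ∀ i, Q.c i y < 0 →
      t * ((‖gradient (Q.c i) y‖ + 1) * (D * F)) ≤ -(Q.c i y / 2)) ∧ 0 < t := by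
    have h1 : ∀ᶠ t : ℝ in 𝓝[>] 0, t ≤ 1 :=
      mem_nhdsWithin_of_mem_nhds (Iic_mem_nhds one_pos)
    have h2 : ∀ᶠ t : ℝ in 𝓝[>] 0, ∀ i, Q.c i y < 0 →
        t * ((‖gradient (Q.c i) y‖ + 1) * (D * F)) ≤ -(Q.c i y / 2) := by
      refine eventually_all.2 fun i => ?_
      by_cases hi : Q.c i y < 0
      · have hc : Continuous fun t : ℝ => t * ((‖gradient (Q.c i) y‖ + 1) * (D * F)) := by fun_prop
        have := hc.tendsto 0
        rw [zero_mul] at this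
        have h3 := this.eventually (Iic_mem_nhds (show (0 : ℝ) < -(Q.c i y / 2) by linarith))
        exact mem_nhdsWithin_of_mem_nhds (h3.mono fun t ht _ => ht)
      · exact Eventually.of_forall fun t h => absurd h hi
    obtain ⟨t, ht⟩ := ((h1.and h2).and self_mem_nhdsWithin).exists
    exact ⟨t, ht⟩
  -- The step `t • p` would gain the fraction `t` with gradients frozen at `y`; their variation near
  -- `y` costs at most half of it.
  refine ⟨D, t / 2, by linarith, by linarith, by linarith, ?_⟩
  have ev1 : ∀ᶠ x in 𝓝 y, ∀ i, ‖gradient (Q.h i) x - gradient (Q.h i) y‖ ≤ 1 / (2 * D) := by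
    refine eventually_all.2 fun i => ?_
    have hc : Continuous fun x => ‖gradient (Q.h i) x - gradient (Q.h i) y‖ :=
      ((continuous_gradient (hΩ.smooth_h i)).sub continuous_const).norm
    have := hc.tendsto y
    simp only [sub_self, norm_zero] at this
    exact this.eventually (Iic_mem_nhds hDpos)
  have ev2 : ∀ᶠ x in 𝓝 y, ∀ i, ‖gradient (Q.c i) x - gradient (Q.c i) y‖ ≤ 1 / (2 * D) := by
    refine eventually_all.2 fun i => ?_
    have hc : Continuous fun x => ‖gradient (Q.c i) x - gradient (Q.c i) y‖ :=
      ((continuous_gradient (hΩ.smooth_c i)).sub continuous_const).norm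
    have := hc.tendsto y
    simp only [sub_self, norm_zero] at this
    exact this.eventually (Iic_mem_nhds hDpos)
  have ev3 : ∀ᶠ x in 𝓝 y, ∀ i, Q.c i y < 0 → Q.c i x ≤ Q.c i y / 2 := by
    refine eventually_all.2 fun i => ?_
    by_cases hi : Q.c i y < 0
    · exact ((hΩ.smooth_c i).continuous.tendsto y).eventually
        (Iic_mem_nhds (show Q.c i y < Q.c i y / 2 by linarith)) |>.mono fun x hx _ => hx
    · exact Eventually.of_forall fun t h => absurd h hi
  have ev4 : ∀ᶠ x in 𝓝 y, Q.phi x ≤ F :=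
    (hΩ.continuous_phi.tendsto y).eventually (Iic_mem_nhds (by linarith))
  filter_upwards [ev1, ev2, ev3, ev4] with x h1 h2 h3 h4
  have hφ := phi_nonneg (Q := Q) x
  obtain ⟨a1, a2⟩ := (phi_le_iff (Q := Q) x hφ).1 le_rfl
  set s : E n := ∑ j, Q.h j x • w j with hs
  -- The term `-s` cancels `h(x)` to first order with the gradients at `y`; adding a multiple of `z`
  -- preserves this and lowers the active inequalities.
  set p : E n := (Q.phi x * D₁) • z - s with hp
  have hsn : ‖s‖ ≤ W * Q.phi x := by
    rw [hs, hW, Finset.sum_mul]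
    refine norm_sum_le_of_le _ fun j _ => ?_
    rw [norm_smul, mul_comm]
    exact mul_le_mul_of_nonneg_left (a1 j) (norm_nonneg _)
  have hpn : ‖p‖ ≤ D * Q.phi x := by
    have : ‖(Q.phi x * D₁) • z‖ = Q.phi x * D₁ * ‖z‖ := by
      rw [norm_smul, Real.norm_of_nonneg (by positivity)]
    calc ‖p‖ ≤ ‖(Q.phi x * D₁) • z‖ + ‖s‖ := norm_sub_le _ _
      _ ≤ Q.phi x * D₁ * ‖z‖ + W * Q.phi x := by rw [this]; gcongr
      _ ≤ D * Q.phi x := by rw [hD]; nlinarith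
  have hpert : ∀ v v' : E n, ‖v' - v‖ ≤ 1 / (2 * D) → |inner ℝ (v' - v) p| ≤ Q.phi x / 2 := by
    intro v v' hv
    calc |inner ℝ (v' - v) p| ≤ ‖v' - v‖ * ‖p‖ := abs_real_inner_le_norm _ _
      _ ≤ 1 / (2 * D) * (D * Q.phi x) := by gcongr
      _ = Q.phi x / 2 := by field_simp
  refine ⟨t • p, ?_, ?_⟩
  · rw [norm_smul, Real.norm_of_nonneg ht0.le]
    exact (mul_le_of_le_one_left (norm_nonneg _) ht1).trans hpn
  rw [linPhi_le_iff x _ (mul_nonneg (by linarith) hφ)]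
  constructor
  · intro i
    have e1 : inner ℝ (gradient (Q.h i) y) p = -Q.h i x := by
      rw [hp, inner_sub_right, inner_smul_right, hz1 i, hs, inner_sum]
      simp [inner_smul_right, hw]
    have e2 : Q.h i x + inner ℝ (gradient (Q.h i) x) (t • p)
        = (1 - t) * Q.h i x + t * inner ℝ (gradient (Q.h i) x - gradient (Q.h i) y) p := by
      rw [inner_smul_right, inner_sub_left, e1]; ring
    rw [e2]
    refine (abs_add_le _ _).trans ?_
    rw [abs_mul, abs_mul, abs_of_nonneg ht0.le, abs_of_nonneg (by linarith : 0 ≤ 1 - t)]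
    have := mul_le_mul_of_nonneg_left (a1 i) (by linarith : 0 ≤ 1 - t)
    have := mul_le_mul_of_nonneg_left (hpert _ _ (h1 i)) ht0.le
    linarith
  · intro i
    rw [inner_smul_right]
    rcases lt_or_ge (Q.c i y) 0 with hi | hi
    · have b1 : inner ℝ (gradient (Q.c i) x) p ≤ (‖gradient (Q.c i) y‖ + 1) * (D * F) := by
        refine (real_inner_le_norm _ _).trans ?_
        have : ‖gradient (Q.c i) x‖ ≤ ‖gradient (Q.c i) y‖ + 1 := by
          have := norm_le_norm_add_norm_sub' (gradient (Q.c i) x) (gradient (Q.c i) y)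
          linarith [h2 i]
        have : ‖p‖ ≤ D * F := hpn.trans (by gcongr)
        gcongr
      have b2 := mul_le_mul_of_nonneg_left b1 ht0.le
      have b3 : 0 ≤ (1 - t / 2) * Q.phi x := mul_nonneg (by linarith) hφ
      linarith [h3 i hi, htc i hi]
    · have e1 : inner ℝ (gradient (Q.c i) y) p ≤ -Q.phi x := by
        rw [hp, inner_sub_right, inner_smul_right]
        have b1 : -inner ℝ (gradient (Q.c i) y) s ≤ ‖gradient (Q.c i) y‖ * (W * Q.phi x) :=
          (neg_le_abs _).trans ((abs_real_inner_le_norm _ _).trans (by gcongr))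
        have b2 := mul_le_mul_of_nonneg_left (hD₁i i hi) hφ
        linarith
      have e2 : inner ℝ (gradient (Q.c i) x) p ≤ -(Q.phi x / 2) := by
        have := (le_abs_self _).trans (hpert _ _ (h2 i))
        rw [inner_sub_left] at this
        linarith
      have := mul_le_mul_of_nonneg_left e2 ht0.le
      linarith [a2 i]

/-- Uniform reduction of the linearized infeasibility on a compact set where the extended MFCQ
holds. -/
theorem RegularOn.exists_deltaPhi_ge (hΩ : Q.RegularOn Ω Lf Lh Lc) (A : Params)
    (hK : IsCompact K) (hMF : ∀ x ∈ K, Q.EMFCQ x) :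
    ∃ c : ℝ, 0 < c ∧ ∀ x ∈ K, c * Q.phi x ≤ Q.deltaPhi x (A.sigma Q x) := by
  -- Local fractions suffice: on a union of two sets the smaller one serves.
  refine hK.induction_on (p := fun s => ∃ c : ℝ, 0 < c ∧
    ∀ x ∈ s, c * Q.phi x ≤ Q.deltaPhi x (A.sigma Q x)) ⟨1, one_pos, by simp⟩ ?_ ?_ ?_
  · rintro s t hst ⟨c, hc, h⟩
    exact ⟨c, hc, fun x hx => h x (hst hx)⟩
  · rintro s t ⟨c, hc, h⟩ ⟨c', hc', h'⟩
    refine ⟨min c c', lt_min hc hc', fun x hx => ?_⟩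
    have hφ := phi_nonneg (Q := Q) x
    rcases hx with hx | hx
    · exact (mul_le_mul_of_nonneg_right (min_le_left _ _) hφ).trans (h x hx)
    · exact (mul_le_mul_of_nonneg_right (min_le_right _ _) hφ).trans (h' x hx)
  · intro y hy
    obtain ⟨D, c, hD, hc, hc1, hev⟩ := hΩ.eventually_linPhi_le (hMF y hy)
    set F : ℝ := Q.phi y + 1 with hF
    have hF0 : 0 < F := by linarith [phi_nonneg (Q := Q) y]
    have ev4 : ∀ᶠ x in 𝓝 y, Q.phi x ≤ F :=
      (hΩ.continuous_phi.tendsto y).eventually (Iic_mem_nhds (by linarith))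
    -- Since `‖p‖ ≤ D φ(x)`, one factor independent of `x` fits `p` under both parts of `σ`: the
    -- third entry handles `κ_u φ`, the second `σ_u` because `φ ≤ F` near `y`.
    set t : ℝ := min 1 (min (A.σu / (D * F)) (A.κu / D)) with ht
    have hσu := A.σu_pos
    have hκu := A.κu_pos
    have ht0 : 0 < t := lt_min one_pos (lt_min (by positivity) (by positivity))
    have ht1 : t ≤ 1 := min_le_left _ _
    have ht2 : t * (D * F) ≤ A.σu :=
      (le_div_iff₀ (by positivity)).1 ((min_le_right _ _).trans (min_le_left _ _))
    have ht3 : t * D ≤ A.κu :=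
      (le_div_iff₀ hD).1 ((min_le_right _ _).trans (min_le_right _ _))
    refine ⟨{x | c * t * Q.phi x ≤ Q.deltaPhi x (A.sigma Q x)}, ?_, c * t, by positivity,
      fun x hx => hx⟩
    refine mem_nhdsWithin_of_mem_nhds ?_
    filter_upwards [hev, ev4] with x ⟨p, hp1, hp2⟩ hx
    have hφ := phi_nonneg (Q := Q) x
    have hsup : supNorm (t • p) ≤ A.sigma Q x := by
      rw [supNorm_smul, abs_of_pos ht0]
      have h1 : t * supNorm p ≤ t * (D * Q.phi x) := by
        gcongr
        exact (supNorm_le_norm p).trans hp1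
      refine h1.trans (le_min ?_ ?_)
      · refine le_trans ?_ ht2
        gcongr
      · rw [← mul_assoc]
        gcongr
    have h1 := kap_le (Q := Q) x hsup
    have h2 := linPhi_smul_le (Q := Q) x p ht0.le ht1
    have h3 := mul_le_mul_of_nonneg_left hp2 ht0.le
    show c * t * Q.phi x ≤ Q.phi x - Q.kap x (A.sigma Q x)
    linarith

/-! ### Measurability of `κ` and `χ`. -/

theorem measurable_of_isClosed_sublevel {f : E n → ℝ} (h : ∀ a, IsClosed {x | f x ≤ a}) :
    Measurable f :=
  measurable_of_Iic fun a => (h a).measurableSet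

/-- All trust regions lie in the compact `ℓ∞` ball of radius `σ_u`, so a sublevel set is the
projection of a closed set along it. -/
theorem RegularOn.measurable_kap (hΩ : Q.RegularOn Ω Lf Lh Lc) (A : Params) :
    Measurable fun x => Q.kap x (A.sigma Q x) := by
  refine measurable_of_isClosed_sublevel fun a => ?_
  have hcl : IsClosed {y : E n × E n | supNorm y.2 ≤ A.sigma Q y.1 ∧ Q.linPhi y.1 y.2 ≤ a} := by
    refine (isClosed_le (continuous_supNorm.comp continuous_snd) ?_).inter
      (isClosed_le hΩ.continuous_linPhi continuous_const)
    exact continuous_const.min (continuous_const.mul (hΩ.continuous_phi.comp continuous_fst))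
  convert isClosed_exists_mem_of_isCompact (isCompact_supNorm_le (n := n) A.σu) hcl using 1
  ext x
  constructor
  · intro hx
    obtain ⟨p, hp, hpe⟩ := exists_kap_eq (Q := Q) x (sigma_nonneg A x)
    exact ⟨p, hp.trans (min_le_left _ _), hp, hpe.trans_le hx⟩
  · rintro ⟨p, -, hp, hpe⟩
    exact (kap_le x hp).trans hpe

theorem zero_mem_chiFeasible {βl : ℝ} (hβ : 0 ≤ βl) (x : E n) : 0 ∈ Q.chiFeasible βl x :=
  ⟨by simp, by simp, by rw [supNorm_zero]; positivity⟩

theorem isClosed_chiFeasible (βl : ℝ) (x : E n) : IsClosed (Q.chiFeasible βl x) := by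
  have h1 : IsClosed {t : E n | ∀ i, inner ℝ (gradient (Q.h i) x) t = 0} := by
    simp only [Set.ofPred_forall]
    exact isClosed_iInter fun i => isClosed_eq (by fun_prop) continuous_const
  have h2 : IsClosed {t : E n | ∀ i, inner ℝ (gradient (Q.c i) x) t ≤ 0} := by
    simp only [Set.ofPred_forall]
    exact isClosed_iInter fun i => isClosed_le (by fun_prop) continuous_const
  exact h1.inter (h2.inter (isClosed_le continuous_supNorm continuous_const))

theorem exists_chi_eq {βl : ℝ} (hβ : 0 ≤ βl) (x : E n) :
    ∃ t ∈ Q.chiFeasible βl x, Q.chi βl x = -inner ℝ (gradient Q.f x) t := by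
  have hc : IsCompact (Q.chiFeasible βl x) :=
    (isCompact_supNorm_le (βl / 2)).of_isClosed_subset (isClosed_chiFeasible βl x)
      fun t ht => ht.2.2
  obtain ⟨t, ht, he⟩ := (hc.image (f := fun t => inner ℝ (gradient Q.f x) t)
    (by fun_prop)).sInf_mem (Set.Nonempty.image _ ⟨0, zero_mem_chiFeasible hβ x⟩)
  exact ⟨t, ht, by rw [chi, ← he]⟩

theorem le_chi {βl : ℝ} {x t : E n} (ht : t ∈ Q.chiFeasible βl x) :
    -inner ℝ (gradient Q.f x) t ≤ Q.chi βl x := by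
  refine neg_le_neg (csInf_le ⟨-(‖gradient Q.f x‖ * (Real.sqrt n * (βl / 2))), ?_⟩ ⟨t, ht, rfl⟩)
  rintro _ ⟨s, hs, rfl⟩
  have h1 : ‖s‖ ≤ Real.sqrt n * (βl / 2) :=
    (norm_le_supNorm s).trans (mul_le_mul_of_nonneg_left hs.2.2 (Real.sqrt_nonneg _))
  have h2 := (neg_le_abs _).trans (abs_real_inner_le_norm (gradient Q.f x) s)
  have h3 := mul_le_mul_of_nonneg_left h1 (norm_nonneg (gradient Q.f x))
  show _ ≤ inner ℝ (gradient Q.f x) s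
  linarith

theorem chi_nonneg {βl : ℝ} (hβ : 0 ≤ βl) (x : E n) : 0 ≤ Q.chi βl x := by
  simpa using le_chi (zero_mem_chiFeasible (Q := Q) hβ x)

/-- The feasible cone may jump with `x`, so only semicontinuity is claimed: sublevel sets of `-χ`
are closed. -/
theorem RegularOn.measurable_chi (hΩ : Q.RegularOn Ω Lf Lh Lc) {βl : ℝ} (hβ : 0 ≤ βl) :
    Measurable (Q.chi βl) := by
  suffices h : Measurable fun x => -Q.chi βl x by
    exact measurable_neg_iff.1 h
  refine measurable_of_isClosed_sublevel fun a => ?_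
  have hcl : IsClosed {y : E n × E n | ((∀ i, inner ℝ (gradient (Q.h i) y.1) y.2 = 0) ∧
      (∀ i, inner ℝ (gradient (Q.c i) y.1) y.2 ≤ 0)) ∧ inner ℝ (gradient Q.f y.1) y.2 ≤ a} := by
    have hg : ∀ {f : E n → ℝ}, ContDiff ℝ 1 f →
        Continuous fun y : E n × E n => inner ℝ (gradient f y.1) y.2 := fun hf =>
      ((continuous_gradient hf).comp continuous_fst).inner continuous_snd
    have h1 : IsClosed {y : E n × E n | ∀ i, inner ℝ (gradient (Q.h i) y.1) y.2 = 0} := by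
      simp only [Set.ofPred_forall]
      exact isClosed_iInter fun i => isClosed_eq (hg (hΩ.smooth_h i)) continuous_const
    have h2 : IsClosed {y : E n × E n | ∀ i, inner ℝ (gradient (Q.c i) y.1) y.2 ≤ 0} := by
      simp only [Set.ofPred_forall]
      exact isClosed_iInter fun i => isClosed_le (hg (hΩ.smooth_c i)) continuous_const
    exact (h1.inter h2).inter (isClosed_le (hg hΩ.smooth_f) continuous_const)
  convert isClosed_exists_mem_of_isCompact (isCompact_supNorm_le (n := n) (βl / 2)) hcl using 1
  ext x
  constructor
  · intro hx
    obtain ⟨t, ht, he⟩ := exists_chi_eq (Q := Q) hβ x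
    exact ⟨t, ht.2.2, ⟨ht.1, ht.2.1⟩, by
      have : -Q.chi βl x ≤ a := hx
      linarith⟩
  · rintro ⟨t, h1, ⟨h2, h3⟩, h4⟩
    have := le_chi (Q := Q) (βl := βl) (x := x) (t := t) ⟨h2, h3, h1⟩
    show -Q.chi βl x ≤ a
    have h5 : inner ℝ (gradient Q.f x) t ≤ a := h4
    linarith

end Problem

end StochSQP

/-! ### Taylor estimates and bounds on the search direction. -/

namespace StochSQP

open Filter Topology

/-- Mean value inequality for the remainder along the segment. The constant `L` in place of `L / 2`
affects only the choice of the critical level `m`. -/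
theorem abs_taylor_le {n : ℕ} {f : E n → ℝ} (hf : ContDiff ℝ 1 f) {Ω : Set (E n)} {L : NNReal}
    (hL : LipschitzOnWith L (gradient f) Ω) {x d : E n} {α : ℝ} (hα : 0 ≤ α)
    (hseg : ∀ t ∈ Set.Icc (0 : ℝ) α, x + t • d ∈ Ω) :
    |f (x + α • d) - f x - α * inner ℝ (gradient f x) d| ≤ L * (α ^ 2 * ‖d‖ ^ 2) := by
  have hder : ∀ t : ℝ, HasDerivAt (fun t : ℝ => f (x + t • d) - t * inner ℝ (gradient f x) d)
      (inner ℝ (gradient f (x + t • d) - gradient f x) d) t := by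
    intro t
    have h1 : HasFDerivAt f (InnerProductSpace.toDual ℝ (E n) (gradient f (x + t • d)))
        (x + t • d) :=
      ((hf.differentiable (by norm_num)) (x + t • d)).hasGradientAt
    have h2 : HasDerivAt (fun t : ℝ => x + t • d) d t := by
      simpa using ((hasDerivAt_id t).smul_const d).const_add x
    have h3 := h1.comp_hasDerivAt t h2
    have h4 := h3.sub ((hasDerivAt_id t).mul_const (inner ℝ (gradient f x) d))
    rw [InnerProductSpace.toDual_apply_apply, one_mul, ← inner_sub_left] at h4
    exact h4
  have hb : ∀ t ∈ Set.Ico (0 : ℝ) α,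
      ‖inner ℝ (gradient f (x + t • d) - gradient f x) d‖ ≤ L * (α * ‖d‖ ^ 2) := by
    intro t ht
    have hx : x ∈ Ω := by simpa using hseg 0 ⟨le_rfl, hα⟩
    have h1 := hL.norm_sub_le (hseg t ⟨ht.1, ht.2.le⟩) hx
    have h2 : ‖x + t • d - x‖ ≤ α * ‖d‖ := by
      rw [add_sub_cancel_left, norm_smul, Real.norm_of_nonneg ht.1]
      exact mul_le_mul_of_nonneg_right ht.2.le (norm_nonneg _)
    calc ‖inner ℝ (gradient f (x + t • d) - gradient f x) d‖
        ≤ ‖gradient f (x + t • d) - gradient f x‖ * ‖d‖ := norm_inner_le_norm _ _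
      _ ≤ L * (α * ‖d‖) * ‖d‖ := by
          gcongr
          exact h1.trans (by gcongr)
      _ = L * (α * ‖d‖ ^ 2) := by ring
  have := norm_image_sub_le_of_norm_deriv_le_segment'
    (fun t _ => (hder t).hasDerivWithinAt) hb α ⟨hα, le_rfl⟩
  simp only [zero_smul, add_zero, zero_mul, sub_zero, Real.norm_eq_abs] at this
  calc |f (x + α • d) - f x - α * inner ℝ (gradient f x) d|
      = |f (x + α • d) - α * inner ℝ (gradient f x) d - f x| := by congr 1; ring
    _ ≤ L * (α * ‖d‖ ^ 2) * α := this
    _ = L * (α ^ 2 * ‖d‖ ^ 2) := by ring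

namespace Problem

variable {n m₁ m₂ : ℕ} {Q : Problem n m₁ m₂}
  {Ω K : Set (E n)} {Lf : NNReal} {Lh : Fin m₁ → NNReal} {Lc : Fin m₂ → NNReal}

/-- Convexity of the linear model gives the gain proportional to `α`, which is why `α ≤ 1` is
required; Taylor's formula adds one remainder bound common to all constraints. -/
theorem RegularOn.phi_add_smul_le (hΩ : Q.RegularOn Ω Lf Lh Lc) {x d : E n} {α σ : ℝ}
    (hα : 0 ≤ α) (hα1 : α ≤ 1) (hseg : ∀ t ∈ Set.Icc (0 : ℝ) α, x + t • d ∈ Ω)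
    (hd : Q.linPhi x d ≤ Q.kap x σ) :
    Q.phi (x + α • d) ≤ Q.phi x - α * Q.deltaPhi x σ + Lhc Lh Lc * (α ^ 2 * ‖d‖ ^ 2) := by
  have hL : 0 ≤ Lhc Lh Lc := NNReal.coe_nonneg _
  have hLh : ∀ i, (Lh i : ℝ) ≤ Lhc Lh Lc := fun i =>
    NNReal.coe_le_coe.2 ((Finset.le_sup (Finset.mem_univ i)).trans (le_max_left _ _))
  have hLc : ∀ i, (Lc i : ℝ) ≤ Lhc Lh Lc := fun i =>
    NNReal.coe_le_coe.2 ((Finset.le_sup (Finset.mem_univ i)).trans (le_max_right _ _))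
  have hn : 0 ≤ α ^ 2 * ‖d‖ ^ 2 := by positivity
  have hl := linPhi_nonneg (Q := Q) x (α • d)
  obtain ⟨b1, b2⟩ := (linPhi_le_iff (Q := Q) x (α • d) hl).1 le_rfl
  have h1 : Q.phi (x + α • d) ≤ Q.linPhi x (α • d) + Lhc Lh Lc * (α ^ 2 * ‖d‖ ^ 2) := by
    rw [phi_le_iff _ (by positivity)]
    constructor
    · intro i
      have h := (abs_taylor_le (hΩ.smooth_h i) (hΩ.lip_h i) hα hseg).trans
        (mul_le_mul_of_nonneg_right (hLh i) hn)
      have h' := b1 i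
      rw [inner_smul_right] at h'
      calc |Q.h i (x + α • d)| = |(Q.h i x + α * inner ℝ (gradient (Q.h i) x) d)
            + (Q.h i (x + α • d) - Q.h i x - α * inner ℝ (gradient (Q.h i) x) d)| := by
              congr 1; ring
        _ ≤ _ := (abs_add_le _ _).trans (add_le_add h' h)
    · intro i
      have h := (le_abs_self _).trans ((abs_taylor_le (hΩ.smooth_c i) (hΩ.lip_c i) hα hseg).trans
        (mul_le_mul_of_nonneg_right (hLc i) hn))
      have h' := b2 i
      rw [inner_smul_right] at h'
      linarith
  have h2 := linPhi_smul_le (Q := Q) x d hα hα1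
  have h3 := mul_le_mul_of_nonneg_left hd hα
  rw [deltaPhi]
  linarith

theorem RegularOn.Psi_add_smul_le (hΩ : Q.RegularOn Ω Lf Lh Lc) {x d : E n} {α σ ρ : ℝ}
    (hρ : 0 ≤ ρ) (hα : 0 ≤ α) (hα1 : α ≤ 1) (hseg : ∀ t ∈ Set.Icc (0 : ℝ) α, x + t • d ∈ Ω)
    (hd : Q.linPhi x d ≤ Q.kap x σ) :
    Q.Psi ρ (x + α • d) ≤ Q.Psi ρ x
      + α * (inner ℝ (gradient Q.f x) d - ρ * Q.deltaPhi x σ)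
      + (Lf + ρ * Lhc Lh Lc) * (α ^ 2 * ‖d‖ ^ 2) := by
  have h1 := (le_abs_self _).trans (abs_taylor_le hΩ.smooth_f hΩ.lip_f hα hseg)
  have h2 := mul_le_mul_of_nonneg_left (hΩ.phi_add_smul_le hα hα1 hseg hd) hρ
  rw [Psi, Psi]
  linarith

/-- For a large penalty parameter the model reduction dominates the quadratic term. -/
theorem RegularOn.exists_penalty (hΩ : Q.RegularOn Ω Lf Lh Lc) (A : Params)
    (hK : IsCompact K) (hMF : ∀ x ∈ K, Q.EMFCQ x) {MH : ℝ} (hMH : 0 < MH) :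
    ∃ ρs : ℝ, 0 < ρs ∧ ∀ x ∈ K, ∀ (g d : E n) (H : Matrix (Fin n) (Fin n) ℝ) (β ρ : ℝ),
      ‖g‖ ≤ A.ζ₀ → (∀ v, quad H v ≤ MH * ‖v‖ ^ 2) → A.βl ≤ β →
      IsMinOn (fun v => inner ℝ g v + 1 / 2 * quad H v)
        (Q.qpFeasible x (Q.kap x (A.sigma Q x)) β) d → ρs ≤ ρ →
      1 / 2 * quad H d ≤ -inner ℝ g d + ρ * Q.deltaPhi x (A.sigma Q x) := by
  obtain ⟨c, hc, hcK⟩ := hΩ.exists_deltaPhi_ge A hK hMF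
  have hσu := A.σu_pos
  have hκu := A.κu_pos
  have hζ := A.ζ₀_pos
  set s := Real.sqrt n with hs
  have hs0 : 0 ≤ s := Real.sqrt_nonneg _
  set C : ℝ := A.ζ₀ * s + 1 / 2 * MH * s ^ 2 * A.σu + 1 with hC
  have hC0 : 0 < C := by positivity
  refine ⟨C * A.κu / c, by positivity, fun x hx g d H β ρ hg hH hβ hmin hρ => ?_⟩
  have hφ := phi_nonneg (Q := Q) x
  have hσ0 := sigma_nonneg (Q := Q) A x
  have hσ1 : A.sigma Q x ≤ A.σu := min_le_left _ _
  have hσ2 : A.sigma Q x ≤ A.κu * Q.phi x := min_le_right _ _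
  obtain ⟨p, hp, hpe⟩ := exists_kap_eq (Q := Q) x hσ0
  -- The minimizer in the definition of `κ` is a competitor in the quadratic program because `2 σ_u
  -- < β_l ≤ β`. Its objective is of order `σ`, hence of order `φ`, hence of order `Δ_φ`.
  have hpf : p ∈ Q.qpFeasible x (Q.kap x (A.sigma Q x)) β := by
    rw [mem_qpFeasible_iff x p (kap_nonneg x _)]
    exact ⟨hpe.le, by linarith [A.βl_gt]⟩
  have h1 : inner ℝ g d + 1 / 2 * quad H d ≤ inner ℝ g p + 1 / 2 * quad H p := hmin hpf
  have hpn : ‖p‖ ≤ s * A.sigma Q x :=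
    (norm_le_supNorm p).trans (mul_le_mul_of_nonneg_left hp hs0)
  have h2 : inner ℝ g p ≤ A.ζ₀ * (s * A.sigma Q x) :=
    (real_inner_le_norm _ _).trans (by gcongr)
  have h3 : quad H p ≤ MH * (s * A.sigma Q x) ^ 2 := (hH p).trans (by gcongr)
  have h4 : MH * (s * A.sigma Q x) ^ 2 ≤ MH * s ^ 2 * A.σu * A.sigma Q x := by
    have : A.sigma Q x * A.sigma Q x ≤ A.σu * A.sigma Q x := by gcongr
    have := mul_le_mul_of_nonneg_left this (by positivity : 0 ≤ MH * s ^ 2)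
    linarith
  have h5 : inner ℝ g d + 1 / 2 * quad H d ≤ C * A.sigma Q x := by
    rw [hC]; linarith
  have h6 : C * A.sigma Q x ≤ C * A.κu / c * (c * Q.phi x) := by
    calc C * A.sigma Q x ≤ C * (A.κu * Q.phi x) := by gcongr
      _ = _ := by field_simp
  have h7 : C * A.κu / c * (c * Q.phi x) ≤ ρ * Q.deltaPhi x (A.sigma Q x) :=
    mul_le_mul hρ (hcK x hx) (by positivity) ((by positivity : 0 ≤ C * A.κu / c).trans hρ)
  linarith

theorem exists_gradient_bound {f : E n → ℝ} (hf : ContDiff ℝ 1 f) (hK : IsCompact K) :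
    ∃ G : ℝ, 0 ≤ G ∧ ∀ x ∈ K, ‖gradient f x‖ ≤ G := by
  obtain ⟨G, hG⟩ := hK.exists_bound_of_continuousOn (continuous_gradient hf).continuousOn
  exact ⟨max G 0, le_max_right _ _, fun x hx => (hG x hx).trans (le_max_left _ _)⟩

/-- The direction realizes at least the reduction `c φ` of the linear model, while a displacement
`d` changes that model by at most `G ‖d‖`. -/
theorem RegularOn.exists_phi_le_mul_norm (hΩ : Q.RegularOn Ω Lf Lh Lc) (A : Params)
    (hK : IsCompact K) (hMF : ∀ x ∈ K, Q.EMFCQ x) :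
    ∃ C : ℝ, ∀ x ∈ K, ∀ d : E n, Q.linPhi x d ≤ Q.kap x (A.sigma Q x) →
      Q.phi x ≤ C * ‖d‖ := by
  obtain ⟨c, hc, hcK⟩ := hΩ.exists_deltaPhi_ge A hK hMF
  choose Gh hGh0 hGh using fun i => exists_gradient_bound (hΩ.smooth_h i) hK
  choose Gc hGc0 hGc using fun i => exists_gradient_bound (hΩ.smooth_c i) hK
  set G : ℝ := ∑ i, Gh i + ∑ i, Gc i with hG
  have hGhG : ∀ i, Gh i ≤ G := fun i => by
    have := Finset.single_le_sum (f := Gh) (fun i _ => hGh0 i) (Finset.mem_univ i)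
    have := Finset.sum_nonneg fun i (_ : i ∈ Finset.univ) => hGc0 i
    linarith
  have hGcG : ∀ i, Gc i ≤ G := fun i => by
    have := Finset.single_le_sum (f := Gc) (fun i _ => hGc0 i) (Finset.mem_univ i)
    have := Finset.sum_nonneg fun i (_ : i ∈ Finset.univ) => hGh0 i
    linarith
  have hG0 : 0 ≤ G := add_nonneg (Finset.sum_nonneg fun i _ => hGh0 i)
    (Finset.sum_nonneg fun i _ => hGc0 i)
  refine ⟨G / c, fun x hx d hd1 => ?_⟩
  have hl := linPhi_nonneg (Q := Q) x d
  obtain ⟨b1, b2⟩ := (linPhi_le_iff (Q := Q) x d hl).1 le_rfl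
  have h1 : Q.phi x ≤ Q.linPhi x d + G * ‖d‖ := by
    rw [phi_le_iff x (by positivity)]
    constructor
    · intro i
      have h : |inner ℝ (gradient (Q.h i) x) d| ≤ G * ‖d‖ :=
        (abs_real_inner_le_norm _ _).trans (by gcongr; exact (hGh i x hx).trans (hGhG i))
      have h' := b1 i
      rw [abs_le] at h h' ⊢
      constructor <;> linarith
    · intro i
      have h : |inner ℝ (gradient (Q.c i) x) d| ≤ G * ‖d‖ :=
        (abs_real_inner_le_norm _ _).trans (by gcongr; exact (hGc i x hx).trans (hGcG i))
      have h' := b2 i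
      rw [abs_le] at h
      linarith
  have h2 := hcK x hx
  rw [deltaPhi] at h2
  rw [div_mul_eq_mul_div, le_div_iff₀ hc]
  linarith

/-- Let `t` attain `χ`. If `‖d‖_∞ > β_l / 2`, boundedness of `∇f` and `t` is enough. Otherwise `d +
r t` stays feasible for `0 ≤ r ≤ 1`, and optimality of `d` gives `-r gᵀt ≤ ½ (d + r t)ᵀ H (d + r
t)`; with `r` of order `‖d‖`, dividing by `r` leaves a bound of order `‖d‖`. No multipliers are
needed. -/
theorem RegularOn.exists_chi_le_mul_norm (hΩ : Q.RegularOn Ω Lf Lh Lc) (A : Params)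
    (hK : IsCompact K) {ξ MH κg : ℝ} (hξ : 0 < ξ) (hMH : 0 < MH) (hκg : 0 < κg) :
    ∃ C : ℝ, ∀ x ∈ K, ∀ (g d : E n) (H : Matrix (Fin n) (Fin n) ℝ) (κ β α : ℝ),
      (∀ v, 2 * ξ * ‖v‖ ^ 2 ≤ quad H v ∧ quad H v ≤ MH * ‖v‖ ^ 2) → β ∈ Set.Icc A.βl A.βu →
      d ∈ Q.qpFeasible x κ β →
      IsMinOn (fun v => inner ℝ g v + 1 / 2 * quad H v) (Q.qpFeasible x κ β) d →
      α ≤ A.αmax → ‖g - gradient Q.f x‖ ≤ κg * α * ‖d‖ →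
      Q.chi A.βl x ≤ C * ‖d‖ := by
  obtain ⟨Gf, hGf0, hGf⟩ := exists_gradient_bound hΩ.smooth_f hK
  set s := Real.sqrt n with hs
  have hs0 : 0 ≤ s := Real.sqrt_nonneg _
  have hβl : 0 < A.βl := by linarith [A.βl_gt, A.σu_pos]
  have hβu : 0 < A.βu := by linarith [A.βu_gt]
  have hαm := A.αmax_pos
  set T : ℝ := s * (A.βl / 2) with hT
  have hT0 : 0 ≤ T := by positivity
  set D : ℝ := s * A.βu + 1 with hD
  have hD0 : 0 < D := by positivity
  set C₁ : ℝ := 1 / 2 * MH * (1 + T / D) ^ 2 * D with hC₁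
  have hC₁0 : 0 < C₁ := by positivity
  set X : ℝ := Gf * s + (C₁ + κg * A.αmax * T) with hX
  have hX0 : 0 < X := by positivity
  refine ⟨X, fun x hx g d H κ β α hH hβ hdm hmin hα hg => ?_⟩
  have hd2 : supNorm d ≤ β := hdm.2.2
  have hdn : 0 ≤ ‖d‖ := norm_nonneg d
  obtain ⟨t, ⟨ht1, ht2, ht3⟩, hte⟩ := exists_chi_eq (Q := Q) hβl.le x
  rw [hte]
  have htn : ‖t‖ ≤ T := (norm_le_supNorm t).trans (mul_le_mul_of_nonneg_left ht3 hs0)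
  rcases lt_or_ge (A.βl / 2) (supNorm d) with hcase | hcase
  · have h1 : A.βl / 2 ≤ ‖d‖ := hcase.le.trans (supNorm_le_norm d)
    have h2 := (neg_le_abs _).trans (abs_real_inner_le_norm (gradient Q.f x) t)
    have h3 : ‖gradient Q.f x‖ * ‖t‖ ≤ Gf * (s * ‖d‖) := by
      have : ‖t‖ ≤ s * ‖d‖ := htn.trans (mul_le_mul_of_nonneg_left h1 hs0)
      have := hGf x hx
      gcongr
    have h4 : 0 ≤ (C₁ + κg * A.αmax * T) * ‖d‖ := by positivity
    rw [hX]; linarith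
  · have hgt : -inner ℝ g t ≤ C₁ * ‖d‖ := by
      refine le_of_forall_pos_lt_add fun η hη => ?_
      -- Keeps `r` positive when `d = 0`; its effect is below `η`, which is arbitrary.
      set δ : ℝ := min 1 (η / (2 * C₁)) with hδ
      have hδ0 : 0 < δ := lt_min one_pos (by positivity)
      have hδ1 : δ ≤ 1 := min_le_left _ _
      have hδ2 : C₁ * δ ≤ η / 2 := by
        have : δ ≤ η / (2 * C₁) := min_le_right _ _
        calc C₁ * δ ≤ C₁ * (η / (2 * C₁)) := by gcongr
          _ = η / 2 := by field_simp
      -- The denominator `D` exceeds every admissible `‖d‖` by one, so `r ≤ 1`.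
      set r : ℝ := (‖d‖ + δ) / D with hr
      have hr0 : 0 < r := by positivity
      have hr1 : r ≤ 1 := by
        rw [hr, div_le_one hD0, hD]
        have : ‖d‖ ≤ s * A.βu :=
          (norm_le_supNorm d).trans (mul_le_mul_of_nonneg_left (hd2.trans hβ.2) hs0)
        linarith
      have hfeas : d + r • t ∈ Q.qpFeasible x κ β := by
        refine ⟨fun i => ?_, fun i => ?_, ?_⟩
        · rw [inner_add_right, inner_smul_right, ht1 i, mul_zero, add_zero]
          exact hdm.1 i
        · rw [inner_add_right, inner_smul_right]
          have := mul_nonpos_of_nonneg_of_nonpos hr0.le (ht2 i)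
          linarith [hdm.2.1 i]
        · refine (supNorm_add_le _ _).trans ?_
          rw [supNorm_smul, abs_of_pos hr0]
          have := mul_le_of_le_one_left (supNorm_nonneg t) hr1
          linarith [hβ.1]
      have h1 : inner ℝ g d + 1 / 2 * quad H d
          ≤ inner ℝ g (d + r • t) + 1 / 2 * quad H (d + r • t) := hmin hfeas
      rw [inner_add_right, inner_smul_right] at h1
      have h2 : 0 ≤ quad H d := le_trans (by positivity) (hH d).1
      have h3 : ‖d + r • t‖ ≤ (1 + T / D) * (‖d‖ + δ) := by
        calc ‖d + r • t‖ ≤ ‖d‖ + r * ‖t‖ := by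
              refine (norm_add_le _ _).trans_eq ?_
              rw [norm_smul, Real.norm_of_nonneg hr0.le]
          _ ≤ (‖d‖ + δ) + r * T := by gcongr; linarith
          _ = (1 + T / D) * (‖d‖ + δ) := by rw [hr]; field_simp
      have h4 : quad H (d + r • t) ≤ MH * ((1 + T / D) * (‖d‖ + δ)) ^ 2 :=
        (hH _).2.trans (by gcongr)
      have h5 : 1 / 2 * (MH * ((1 + T / D) * (‖d‖ + δ)) ^ 2) = r * (C₁ * (‖d‖ + δ)) := by
        rw [hr, hC₁]; field_simp
      have h6 : r * (-inner ℝ g t) ≤ r * (C₁ * (‖d‖ + δ)) := by linarith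
      have h7 := le_of_mul_le_mul_left h6 hr0
      linarith
    have h1 : inner ℝ (g - gradient Q.f x) t ≤ κg * A.αmax * T * ‖d‖ := by
      calc inner ℝ (g - gradient Q.f x) t ≤ ‖g - gradient Q.f x‖ * ‖t‖ := real_inner_le_norm _ _
        _ ≤ κg * A.αmax * ‖d‖ * T := by
            gcongr
            exact hg.trans (by gcongr)
        _ = _ := by ring
    rw [inner_sub_left] at h1
    have h2 : 0 ≤ Gf * s * ‖d‖ := by positivity
    rw [hX]; linarith

/-- With an accurate gradient estimate, the length of the search direction bounds the
infeasibility and the optimality measure. -/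
theorem RegularOn.exists_sq_add_sq_le (hΩ : Q.RegularOn Ω Lf Lh Lc) (A : Params)
    (hK : IsCompact K) (hMF : ∀ x ∈ K, Q.EMFCQ x) {ξ MH κg : ℝ} (hξ : 0 < ξ) (hMH : 0 < MH)
    (hκg : 0 < κg) :
    ∃ C : ℝ, 0 < C ∧ ∀ x ∈ K, ∀ (g d : E n) (H : Matrix (Fin n) (Fin n) ℝ) (β α : ℝ),
      (∀ v, 2 * ξ * ‖v‖ ^ 2 ≤ quad H v ∧ quad H v ≤ MH * ‖v‖ ^ 2) → β ∈ Set.Icc A.βl A.βu →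
      d ∈ Q.qpFeasible x (Q.kap x (A.sigma Q x)) β →
      IsMinOn (fun v => inner ℝ g v + 1 / 2 * quad H v)
        (Q.qpFeasible x (Q.kap x (A.sigma Q x)) β) d →
      α ≤ A.αmax → ‖g - gradient Q.f x‖ ≤ κg * α * ‖d‖ →
      Q.phi x ^ 2 + Q.chi A.βl x ^ 2 ≤ C * ‖d‖ ^ 2 := by
  obtain ⟨C₁, h₁⟩ := hΩ.exists_phi_le_mul_norm A hK hMF
  obtain ⟨C₂, h₂⟩ := hΩ.exists_chi_le_mul_norm A hK hξ hMH hκg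
  refine ⟨C₁ ^ 2 + C₂ ^ 2 + 1, by positivity, fun x hx g d H β α hH hβ hdm hmin hα hg => ?_⟩
  have hβl : 0 < A.βl := by linarith [A.βl_gt, A.σu_pos]
  have hφ := phi_nonneg (Q := Q) x
  have hχ := chi_nonneg (Q := Q) hβl.le x
  have h1 := pow_le_pow_left₀ hφ
    (h₁ x hx d ((mem_qpFeasible_iff x d (kap_nonneg x _)).1 hdm).1) 2
  have h2 := pow_le_pow_left₀ hχ (h₂ x hx g d H _ β α hH hβ hdm hmin hα hg) 2
  nlinarith [sq_nonneg ‖d‖]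

theorem RegularOn.exists_stationarity_bound (hΩ : Q.RegularOn Ω Lf Lh Lc) (hK : IsCompact K)
    {βl : ℝ} (hβ : 0 ≤ βl) :
    ∃ C : ℝ, ∀ x ∈ K, Q.phi x ^ 2 + Q.chi βl x ^ 2 ≤ C := by
  obtain ⟨Gf, hGf0, hGf⟩ := exists_gradient_bound hΩ.smooth_f hK
  obtain ⟨F, hF⟩ := hK.exists_bound_of_continuousOn hΩ.continuous_phi.continuousOn
  refine ⟨F ^ 2 + (Gf * (Real.sqrt n * (βl / 2))) ^ 2, fun x hx => ?_⟩
  have h1 : Q.phi x ≤ F := (le_abs_self _).trans (hF x hx)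
  have h2 : Q.chi βl x ≤ Gf * (Real.sqrt n * (βl / 2)) := by
    obtain ⟨t, ht, hte⟩ := exists_chi_eq (Q := Q) hβ x
    rw [hte]
    refine (neg_le_abs _).trans ((abs_real_inner_le_norm _ _).trans ?_)
    have := (norm_le_supNorm t).trans (mul_le_mul_of_nonneg_left ht.2.2 (Real.sqrt_nonneg _))
    have := hGf x hx
    gcongr
  have := phi_nonneg (Q := Q) x
  have := chi_nonneg (Q := Q) hβ x
  gcongr

end Problem

end StochSQP

/-! ### A drift argument for processes with a step-size level. -/

namespace StochSQP

section

variable {S : Type*} [mS : MeasurableSpace S]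

theorem integrable_of_measurable_of_bound {μ : Measure S} [IsFiniteMeasure μ] {F : MeasurableSpace S}
    (hF : F ≤ mS) {W : S → ℝ} (hW : Measurable[F] W) {C : ℝ} (hC : ∀ ω, |W ω| ≤ C) :
    Integrable W μ :=
  Integrable.of_bound (hW.mono hF le_rfl).aestronglyMeasurable C (ae_of_all _ hC)

/-- A conditional lower bound tested against bounded nonnegative weights known to the conditioning;
in this form the probabilistic assumptions enter the drift argument. -/
theorem integral_mul_le_integral_mul_of_le_condExp {μ : Measure S} [IsFiniteMeasure μ]
    {F : MeasurableSpace S} (hF : F ≤ mS) {W X Z : S → ℝ} (hW : Measurable[F] W) {C : ℝ}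
    (hW0 : ∀ ω, 0 ≤ W ω) (hWC : ∀ ω, W ω ≤ C) (hX : Integrable X μ)
    (hZ : Integrable (fun ω => W ω * Z ω) μ) (h : ∀ᵐ ω ∂μ, Z ω ≤ (μ[X|F]) ω) :
    ∫ ω, W ω * Z ω ∂μ ≤ ∫ ω, W ω * X ω ∂μ := by
  have hb : ∀ᵐ ω ∂μ, ‖W ω‖ ≤ C := ae_of_all _ fun ω => by
    rw [Real.norm_of_nonneg (hW0 ω)]; exact hWC ω
  have h1 : μ[fun ω => W ω * X ω|F] =ᵐ[μ] fun ω => W ω * (μ[X|F]) ω :=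
    condExp_stronglyMeasurable_mul_of_bound hF hW.stronglyMeasurable hX C hb
  have h2 : Integrable (fun ω => W ω * (μ[X|F]) ω) μ :=
    integrable_condExp.bdd_mul (hW.mono hF le_rfl).aestronglyMeasurable hb
  calc ∫ ω, W ω * Z ω ∂μ ≤ ∫ ω, W ω * (μ[X|F]) ω ∂μ :=
        integral_mono_ae hZ h2 (h.mono fun ω hω => mul_le_mul_of_nonneg_left hω (hW0 ω))
    _ = ∫ ω, (μ[fun ω => W ω * X ω|F]) ω ∂μ := (integral_congr_ae h1).symm
    _ = ∫ ω, W ω * X ω ∂μ := integral_condExp hF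

/-- A process with step-size level `lev`, merit value `u` and stationarity measure `e`.
On the good event `A k`, which has conditional probability at least `p`, a step is taken whenever
the level is at least `m`, and a step reduces the merit value by a multiple of `a (lev k) * e k`;
otherwise a step may increase the merit value by at most `err k`. -/
structure LevelProcess (μ : Measure S) (F : ℕ → MeasurableSpace S) (a : ℕ → ℝ) (m : ℕ)
    (c p τ ε : ℝ) (u e err : ℕ → S → ℝ) (lev : ℕ → S → ℕ) (A : ℕ → Set S) : Prop where
  le : ∀ k, F k ≤ mS
  mono : Monotone F
  meas_u : ∀ k, Measurable[F k] (u k)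
  meas_e : ∀ k, Measurable[F k] (e k)
  meas_lev : ∀ k, Measurable[F k] (lev k)
  meas_A : ∀ k, MeasurableSet (A k)
  u_nonneg : ∀ k ω, 0 ≤ u k ω
  u_bdd : ∃ C, ∀ k ω, u k ω ≤ C
  e_nonneg : ∀ k ω, 0 ≤ e k ω
  e_bdd : ∃ C, ∀ k ω, e k ω ≤ C
  err_nonneg : ∀ k ω, 0 ≤ err k ω
  err_int : ∀ k, Integrable (err k) μ
  lev_zero : ∀ ω, lev 0 ω ≤ m
  good : ∀ k W, Measurable[F k] W → (∀ ω, 0 ≤ W ω) → (∃ C, ∀ ω, W ω ≤ C) →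
    p * ∫ ω, W ω ∂μ ≤ ∫ ω in A k, W ω ∂μ
  err_le : ∀ k B, MeasurableSet[F k] B → (∀ ω ∈ B, ε ≤ e k ω) →
    ∫ ω in B, err k ω ∂μ ≤ τ * ∫ ω in B, a (lev k ω) * e k ω ∂μ
  step : ∀ k ω,
    (lev (k + 1) ω = lev k ω + 1 ∧ u (k + 1) ω = u k ω ∧ e (k + 1) ω = e k ω ∧
      (ω ∈ A k → lev k ω < m)) ∨
    (lev (k + 1) ω = lev k ω - 1 ∧ u (k + 1) ω ≤ u k ω + err k ω ∧
      (ω ∈ A k → u (k + 1) ω ≤ u k ω - c * a (lev k ω) * e k ω))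

namespace LevelProcess

variable {μ : Measure S} {F : ℕ → MeasurableSpace S} {a : ℕ → ℝ} {m : ℕ}
  {c p τ ε : ℝ} {u e err : ℕ → S → ℝ} {lev : ℕ → S → ℕ} {A : ℕ → Set S}

theorem lev_le (P : LevelProcess μ F a m c p τ ε u e err lev A) (k : ℕ) (ω : S) :
    lev k ω ≤ m + k := by
  induction k with
  | zero => exact P.lev_zero ω
  | succ k ih => rcases P.step k ω with h | h <;> omega

theorem measure_eq_zero_of_inter [IsProbabilityMeasure μ]
    (P : LevelProcess μ F a m c p τ ε u e err lev A) (hp : 0 < p) {k : ℕ} {B : Set S}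
    (hB : MeasurableSet[F k] B) (h : μ (A k ∩ B) = 0) : μ B = 0 := by
  have hB' : MeasurableSet B := P.le k B hB
  have h1 := P.good k (B.indicator fun _ => 1) (measurable_const.indicator hB)
    (fun ω => Set.indicator_nonneg (fun _ _ => zero_le_one) ω)
    ⟨1, fun ω => Set.indicator_le_self' (fun _ _ => zero_le_one) ω⟩
  rw [integral_indicator hB', setIntegral_indicator hB'] at h1
  simp only [setIntegral_const, smul_eq_mul, mul_one, measureReal_def, h, ENNReal.toReal_zero] at h1
  have h2 : (μ B).toReal ≤ 0 := by
    by_contra hcon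
    exact absurd h1 (not_le.2 (mul_pos hp (not_le.1 hcon)))
  have h3 : (μ B).toReal = 0 := le_antisymm h2 ENNReal.toReal_nonneg
  exact ((ENNReal.toReal_eq_zero_iff _).1 h3).resolve_right (measure_ne_top _ _)

/-- At the coarse levels the merit value dominates the stationarity measure. -/
theorem mul_le_merit [IsProbabilityMeasure μ]
    (P : LevelProcess μ F a m c p τ ε u e err lev A) (ha : Antitone a)
    (hc : 0 < c) (hp : 0 < p) (k : ℕ) :
    ∀ᵐ ω ∂μ, lev k ω ≤ m → c * a m * e k ω ≤ u k ω := by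
  -- Downward induction on the level: at stage `s` the levels in `(m - s, m]` are settled, for all
  -- times at once.
  suffices H : ∀ s k, ∀ᵐ ω ∂μ, lev k ω ≤ m → m < lev k ω + s → c * a m * e k ω ≤ u k ω by
    filter_upwards [H (m + 1) k] with ω hω h1
    exact hω h1 (by omega)
  intro s
  induction s with
  | zero => exact fun k => ae_of_all _ fun ω h1 h2 => absurd h1 (by omega)
  | succ s ih =>
    intro k
    set B : Set S := {ω | (lev k ω ≤ m ∧ m < lev k ω + (s + 1)) ∧ u k ω < c * a m * e k ω} with hBdef
    have hB : MeasurableSet[F k] B := by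
      refine MeasurableSet.inter (P.meas_lev k (MeasurableSet.of_discrete
        (s := {i | i ≤ m ∧ m < i + (s + 1)}))) ?_
      have hd : Measurable[F k] fun ω => u k ω - c * a m * e k ω :=
        (P.meas_u k).sub ((P.meas_e k).const_mul _)
      have hset : {ω | u k ω < c * a m * e k ω}
          = (fun ω => u k ω - c * a m * e k ω) ⁻¹' Set.Iio 0 := by
        ext ω; simp
      have hlt : MeasurableSet[F k] {ω | u k ω < c * a m * e k ω} := by
        rw [hset]; exact hd measurableSet_Iio
      exact hlt
    -- On the good event a violation either leads to a step after which `u` is negative, or is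
    -- carried unchanged to the next level at time `k + 1`, where it is already excluded; at level
    -- `m` the second case cannot occur. A set known at time `k` that almost never meets the good
    -- event is null.
    have h0 : μ (A k ∩ B) = 0 := by
      have : ∀ᵐ ω ∂μ, ω ∉ A k ∩ B := by
        filter_upwards [ih (k + 1)] with ω hω hAB
        obtain ⟨hA, ⟨h1, h2⟩, h3⟩ := hAB
        rcases P.step k ω with ⟨s1, s2, s3, s4⟩ | ⟨-, -, s3⟩
        · have := s4 hA
          have h5 := hω (by omega) (by omega)
          rw [s2, s3] at h5
          linarith
        · have h5 := s3 hA
          have h6 : c * a m * e k ω ≤ c * a (lev k ω) * e k ω :=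
            mul_le_mul_of_nonneg_right (mul_le_mul_of_nonneg_left (ha h1) hc.le) (P.e_nonneg k ω)
          linarith [P.u_nonneg (k + 1) ω]
      simpa [ae_iff] using this
    have h1 := P.measure_eq_zero_of_inter hp hB h0
    have h2 : ∀ᵐ ω ∂μ, ω ∉ B := by rw [ae_iff]; simpa using h1
    filter_upwards [h2] with ω hω a1 a2
    by_contra hcon
    exact hω ⟨⟨a1, a2⟩, not_le.1 hcon⟩

/-- Weight of the stationarity measure in the Lyapunov function. -/
noncomputable def weight (v : ℝ) (m i : ℕ) : ℝ := if i ≤ m then v * 4 ^ i else 0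

theorem weight_nonneg {v : ℝ} (hv : 0 ≤ v) (m i : ℕ) : 0 ≤ weight v m i := by
  unfold weight; split_ifs <;> positivity

theorem weight_le {v : ℝ} (hv : 0 ≤ v) (m i : ℕ) : weight v m i ≤ v * 4 ^ m := by
  unfold weight
  split_ifs with h
  · gcongr
    norm_num
  · positivity

/-- The Lyapunov function: the stationarity measure enters with a negative sign. -/
noncomputable def lyapunov (v ε : ℝ) (m : ℕ) (u e : ℝ) (i : ℕ) : ℝ :=
  u + ε * v * ((i - m : ℕ) : ℝ) - weight v m i * e

/-- Bound for the increase of the Lyapunov function off the good event. -/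
noncomputable def increaseBound (v ε : ℝ) (m : ℕ) (e : ℝ) (i : ℕ) : ℝ :=
  2 * weight v m i * e + if i ≤ m then 0 else ε * v

/-- Bound for the extra decrease of the Lyapunov function on the good event. -/
noncomputable def decreaseBound (v ε c : ℝ) (a : ℕ → ℝ) (m : ℕ) (e : ℝ) (i : ℕ) : ℝ :=
  (if i ≤ m then 5 * weight v m i else c * a i) * e + if i ≤ m then 0 else 2 * (ε * v)

/-- At coarse levels, with `w = weight v m (lev k ω)`, the loss is at most `2 w e` plus `err`, while
a good event yields a net gain of `3 w e`: a failure below `m` quadruples the weight, and a step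
lowers `u` by at least `4 w e` at the cost of the term `w e`. At fine levels a good event forces a
step, which also lowers the level penalty by `ε v`. -/
theorem lyapunov_step (P : LevelProcess μ F a m c p τ ε u e err lev A) (ha : Antitone a)
    (ha0 : ∀ i, 0 < a i) (hc : 0 < c) (hε : 0 < ε) {v : ℝ} (hv : v = c * a m / 4 ^ (m + 1))
    {k : ℕ} {ω : S} (he : ε ≤ e k ω) :
    lyapunov v ε m (u (k + 1) ω) (e (k + 1) ω) (lev (k + 1) ω) ≤
      lyapunov v ε m (u k ω) (e k ω) (lev k ω) + increaseBound v ε m (e k ω) (lev k ω)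
      - (A k).indicator (fun _ => decreaseBound v ε c a m (e k ω) (lev k ω)) ω + err k ω := by
  have hv0 : 0 < v := by rw [hv]; have := ha0 m; positivity
  have hvm : 4 * (v * 4 ^ m) = c * a m := by rw [hv, pow_succ]; field_simp
  have he0 : 0 < e k ω := hε.trans_le he
  have herr := P.err_nonneg k ω
  have hw' : 0 ≤ weight v m (lev (k + 1) ω) * e (k + 1) ω :=
    mul_nonneg (weight_nonneg hv0.le _ _) (P.e_nonneg _ _)
  have hwle := weight_le hv0.le m (lev k ω)
  have hw0 : 0 ≤ weight v m (lev k ω) * e k ω :=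
    mul_nonneg (weight_nonneg hv0.le _ _) (P.e_nonneg _ _)
  have hεv : 0 < ε * v := mul_pos hε hv0
  rcases P.step k ω with ⟨s1, s2, s3, s4⟩ | ⟨s1, s2, s3⟩
  · rcases lt_trichotomy (lev k ω) m with hl | hl | hl
    · have e1 : lev k ω + 1 - m = 0 := by omega
      have e2 : lev k ω - m = 0 := by omega
      have e3 : weight v m (lev k ω + 1) = 4 * weight v m (lev k ω) := by
        unfold weight
        rw [if_pos (by omega), if_pos hl.le]; ring
      have hind : (A k).indicator (fun _ => decreaseBound v ε c a m (e k ω) (lev k ω)) ω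
          ≤ 5 * (weight v m (lev k ω) * e k ω) := by
        refine Set.indicator_apply_le' (fun _ => ?_) fun _ => by positivity
        simp only [decreaseBound, if_pos hl.le]
        linarith
      simp only [lyapunov, increaseBound, s1, s2, s3, e1, e2, e3, if_pos hl.le]
      linarith
    · have hA : ω ∉ A k := fun h => by have := s4 h; omega
      have e1 : lev k ω + 1 - m = 1 := by omega
      have e2 : lev k ω - m = 0 := by omega
      have e3 : weight v m (lev k ω + 1) = 0 := by
        unfold weight
        rw [if_neg (by omega)]
      have e4 : weight v m (lev k ω) = v * 4 ^ m := by
        unfold weight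
        rw [if_pos hl.le, hl]
      -- A failure at level `m` drops the weight to zero and starts the level penalty; the latter is
      -- within another `w e` because `ε ≤ e`.
      have h4 : v ≤ v * 4 ^ m := le_mul_of_one_le_right hv0.le (one_le_pow₀ (by norm_num))
      have h5 : ε * v ≤ v * 4 ^ m * e k ω := by
        rw [mul_comm]
        exact mul_le_mul h4 he hε.le (by positivity)
      rw [Set.indicator_of_notMem hA]
      simp only [lyapunov, increaseBound, s1, s2, s3, e1, e2, e3, e4, if_pos hl.le]
      push_cast
      linarith
    · have hA : ω ∉ A k := fun h => by have := s4 h; omega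
      have e1 : ((lev k ω + 1 - m : ℕ) : ℝ) = ((lev k ω - m : ℕ) : ℝ) + 1 := by
        rw [← Nat.cast_succ]; congr 1; omega
      have e3 : weight v m (lev k ω + 1) = 0 := by
        unfold weight
        rw [if_neg (by omega)]
      have e4 : weight v m (lev k ω) = 0 := by
        unfold weight
        rw [if_neg (by omega)]
      rw [Set.indicator_of_notMem hA]
      simp only [lyapunov, increaseBound, s1, s2, s3, e1, e3, e4, if_neg (not_le.2 hl)]
      linarith
  · have hmono : ((lev k ω - 1 - m : ℕ) : ℝ) ≤ ((lev k ω - m : ℕ) : ℝ) := by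
      exact_mod_cast (by omega : lev k ω - 1 - m ≤ lev k ω - m)
    have hmono' := mul_le_mul_of_nonneg_left hmono hεv.le
    by_cases hA : ω ∈ A k
    · have s3' := s3 hA
      rw [Set.indicator_of_mem hA]
      rcases le_or_gt (lev k ω) m with hl | hl
      · have h6 : c * a m * e k ω ≤ c * a (lev k ω) * e k ω :=
          mul_le_mul_of_nonneg_right (mul_le_mul_of_nonneg_left (ha hl) hc.le) he0.le
        have h7 := mul_le_mul_of_nonneg_right hwle he0.le
        rw [← hvm] at h6
        simp only [lyapunov, increaseBound, decreaseBound, if_pos hl]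
        rw [s1] at hw' ⊢
        linarith
      · have e1 : ((lev k ω - m : ℕ) : ℝ) = ((lev k ω - 1 - m : ℕ) : ℝ) + 1 := by
          rw [← Nat.cast_succ]; congr 1; omega
        simp only [lyapunov, increaseBound, decreaseBound, if_neg (not_le.2 hl)]
        rw [s1] at hw' ⊢
        rw [e1]
        linarith
    · rw [Set.indicator_of_notMem hA]
      have : 0 ≤ if lev k ω ≤ m then 0 else ε * v := by split_ifs <;> linarith
      simp only [lyapunov, increaseBound]
      rw [s1] at hw' ⊢
      linarith

/-- At coarse levels `2 - 5 · 3/4 = -7/4` in units of `w e`, and the error costs at most one such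
unit. At fine levels the level terms give `1 - 2 · 3/4 = -1/2` in units of `ε v`, and the decrease
of `u` pays for the error since `τ ≤ c / 4`. -/
theorem drift_le (ha : Antitone a) (ha0 : ∀ i, 0 < a i) (hc : 0 < c) (hp : 3 / 4 ≤ p)
    (hε : 0 < ε) {v : ℝ} (hv : v = c * a m / 4 ^ (m + 1)) (hτ0 : 0 ≤ τ) (hτ : τ * a 0 ≤ v)
    {x : ℝ} (hx : ε ≤ x) (i : ℕ) :
    increaseBound v ε m x i - p * decreaseBound v ε c a m x i + τ * (a i * x) ≤ -(v * ε / 2) := by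
  have hv0 : 0 < v := by rw [hv]; have := ha0 m; positivity
  have hx0 : 0 < x := hε.trans_le hx
  have hai : τ * (a i * x) ≤ τ * a 0 * x := by
    rw [← mul_assoc]
    exact mul_le_mul_of_nonneg_right (mul_le_mul_of_nonneg_left (ha (Nat.zero_le i)) hτ0) hx0.le
  rcases le_or_gt i m with hi | hi
  · have e4 : v ≤ weight v m i := by
      unfold weight
      rw [if_pos hi]
      exact le_mul_of_one_le_right hv0.le (one_le_pow₀ (by norm_num))
    simp only [increaseBound, decreaseBound, if_pos hi]
    have h1 : v * x ≤ weight v m i * x := mul_le_mul_of_nonneg_right e4 hx0.le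
    have h2 : τ * a 0 * x ≤ v * x := mul_le_mul_of_nonneg_right hτ hx0.le
    have h3 : v * ε ≤ v * x := mul_le_mul_of_nonneg_left hx hv0.le
    have h4 : 3 / 4 * (weight v m i * x) ≤ p * (weight v m i * x) :=
      mul_le_mul_of_nonneg_right hp (mul_nonneg (weight_nonneg hv0.le m i) hx0.le)
    have h5 : 0 < v * x := by positivity
    linarith
  · have e4 : weight v m i = 0 := by
      unfold weight
      rw [if_neg (by omega)]
    have hτc : τ ≤ c / 4 := by
      have h1 : v ≤ c * a 0 / 4 := by
        rw [hv]
        have : (4 : ℝ) ≤ 4 ^ (m + 1) := le_self_pow₀ (by norm_num) (by omega)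
        have := ha (Nat.zero_le m)
        have := ha0 m
        have := ha0 0
        gcongr
      have h2 : τ * a 0 ≤ c / 4 * a 0 := by linarith
      exact le_of_mul_le_mul_right h2 (ha0 0)
    simp only [increaseBound, decreaseBound, if_neg (not_le.2 hi), e4]
    have hax : 0 < a i * x := mul_pos (ha0 i) hx0
    have h1 := mul_le_mul_of_nonneg_right hτc hax.le
    have h2 : 3 / 4 * (c * a i * x) ≤ p * (c * a i * x) :=
      mul_le_mul_of_nonneg_right hp (by have := ha0 i; positivity)
    have h3 : 3 / 4 * (ε * v) ≤ p * (ε * v) := mul_le_mul_of_nonneg_right hp (by positivity)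
    have h4 : 0 < c * (a i * x) := by positivity
    linarith

/-- The event that the process has not been `ε`-stationary up to time `k`. -/
def notYet {T : Type*} (e : ℕ → T → ℝ) (ε : ℝ) (k : ℕ) : Set T := {ω | ∀ j ≤ k, ε ≤ e j ω}

theorem measurableSet_notYet (P : LevelProcess μ F a m c p τ ε u e err lev A) (k : ℕ) :
    MeasurableSet[F k] (notYet e ε k) := by
  have : notYet e ε k = ⋂ j, ⋂ (_ : j ≤ k), {ω | ε ≤ e j ω} := by
    ext ω; simp [notYet]
  rw [this]
  exact @MeasurableSet.iInter _ _ (F k) _ _ fun j => @MeasurableSet.iInter _ _ (F k) _ _ fun hj =>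
    P.mono hj _ (P.meas_e j measurableSet_Ici)

theorem measurable_lyapunov (P : LevelProcess μ F a m c p τ ε u e err lev A) (v : ℝ) (k : ℕ) :
    Measurable[F k] fun ω => lyapunov v ε m (u k ω) (e k ω) (lev k ω) := by
  have h1 : Measurable[F k] fun ω => ε * v * ((lev k ω - m : ℕ) : ℝ) :=
    (measurable_from_nat (f := fun i : ℕ => ε * v * ((i - m : ℕ) : ℝ))).comp (P.meas_lev k)
  have h2 : Measurable[F k] fun ω => weight v m (lev k ω) :=
    (measurable_from_nat (f := weight v m)).comp (P.meas_lev k)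
  exact ((P.meas_u k).add h1).sub (h2.mul (P.meas_e k))

theorem measurable_increaseBound (P : LevelProcess μ F a m c p τ ε u e err lev A) (v : ℝ) (k : ℕ) :
    Measurable[F k] fun ω => increaseBound v ε m (e k ω) (lev k ω) :=
  ((measurable_from_nat (f := fun i => 2 * weight v m i)).comp (P.meas_lev k)
    |>.mul (P.meas_e k)).add
    ((measurable_from_nat (f := fun i => if i ≤ m then 0 else ε * v)).comp (P.meas_lev k))

theorem measurable_decreaseBound (P : LevelProcess μ F a m c p τ ε u e err lev A) (v : ℝ) (k : ℕ) :
    Measurable[F k] fun ω => decreaseBound v ε c a m (e k ω) (lev k ω) :=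
  ((measurable_from_nat (f := fun i => if i ≤ m then 5 * weight v m i else c * a i)).comp
    (P.meas_lev k) |>.mul (P.meas_e k)).add
    ((measurable_from_nat (f := fun i => if i ≤ m then 0 else 2 * (ε * v))).comp (P.meas_lev k))

theorem bounded_of_level (P : LevelProcess μ F a m c p τ ε u e err lev A) (k : ℕ)
    (q : ℕ → ℝ) : ∃ C, ∀ ω, |q (lev k ω)| ≤ C := by
  refine ⟨∑ i ∈ Finset.range (m + k + 1), |q i|, fun ω => ?_⟩
  exact Finset.single_le_sum (f := fun i => |q i|) (fun _ _ => abs_nonneg _)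
    (Finset.mem_range.2 (Nat.lt_succ_of_le (P.lev_le k ω)))

theorem bounded_affine (P : LevelProcess μ F a m c p τ ε u e err lev A) (k : ℕ)
    (q r : ℕ → ℝ) : ∃ C, ∀ ω, |q (lev k ω) * e k ω + r (lev k ω)| ≤ C := by
  obtain ⟨C₁, h₁⟩ := P.bounded_of_level k q
  obtain ⟨C₂, h₂⟩ := P.bounded_of_level k r
  obtain ⟨C, hC⟩ := P.e_bdd
  refine ⟨C₁ * C + C₂, fun ω => (abs_add_le _ _).trans ?_⟩
  rw [abs_mul, abs_of_nonneg (P.e_nonneg k ω)]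
  exact add_le_add (mul_le_mul (h₁ ω) (hC k ω) (P.e_nonneg k ω) ((abs_nonneg _).trans (h₁ ω)))
    (h₂ ω)

theorem bounded_lyapunov (P : LevelProcess μ F a m c p τ ε u e err lev A) (v : ℝ) (k : ℕ) :
    ∃ C, ∀ ω, |lyapunov v ε m (u k ω) (e k ω) (lev k ω)| ≤ C := by
  obtain ⟨C, hC⟩ := P.bounded_affine k (fun i => -weight v m i)
    (fun i => ε * v * ((i - m : ℕ) : ℝ))
  obtain ⟨U, hU⟩ := P.u_bdd
  refine ⟨U + C, fun ω => ?_⟩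
  have : lyapunov v ε m (u k ω) (e k ω) (lev k ω) = u k ω +
      (-weight v m (lev k ω) * e k ω + ε * v * ((lev k ω - m : ℕ) : ℝ)) := by
    unfold lyapunov; ring
  rw [this]
  refine (abs_add_le _ _).trans (add_le_add ?_ (hC ω))
  rw [abs_of_nonneg (P.u_nonneg k ω)]
  exact hU k ω

/-- The event of no hit by time `k` is known at time `k`, so the good-event inequality may be tested
with the decrease bound restricted to it. -/
theorem setIntegral_lyapunov_step [IsProbabilityMeasure μ]
    (P : LevelProcess μ F a m c p τ ε u e err lev A) (ha : Antitone a)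
    (ha0 : ∀ i, 0 < a i) (hc : 0 < c) (hp : 3 / 4 ≤ p) (hε : 0 < ε) {v : ℝ}
    (hv : v = c * a m / 4 ^ (m + 1)) (hτ0 : 0 ≤ τ) (hτ : τ * a 0 ≤ v) (k : ℕ) :
    ∫ ω in notYet e ε k, lyapunov v ε m (u (k + 1) ω) (e (k + 1) ω) (lev (k + 1) ω) ∂μ
      ≤ ∫ ω in notYet e ε k, lyapunov v ε m (u k ω) (e k ω) (lev k ω) ∂μ
        - v * ε / 2 * μ.real (notYet e ε k) := by
  set B := notYet e ε k with hBdef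
  have hv0 : 0 < v := by rw [hv]; have := ha0 m; positivity
  have hBF : MeasurableSet[F k] B := P.measurableSet_notYet k
  have hB : MeasurableSet B := P.le k B hBF
  have heB : ∀ ω ∈ B, ε ≤ e k ω := fun ω hω => hω k le_rfl
  obtain ⟨C₀, hC₀⟩ := P.bounded_lyapunov v k
  obtain ⟨C₁, hC₁⟩ := P.bounded_lyapunov v (k + 1)
  obtain ⟨C₂, hC₂⟩ := P.bounded_affine k (fun i => 2 * weight v m i)
    (fun i => if i ≤ m then 0 else ε * v)
  obtain ⟨C₃, hC₃⟩ := P.bounded_affine k (fun i => if i ≤ m then 5 * weight v m i else c * a i)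
    (fun i => if i ≤ m then 0 else 2 * (ε * v))
  obtain ⟨C₄, hC₄⟩ := P.bounded_affine k a (fun _ => 0)
  have i0 := integrable_of_measurable_of_bound (μ := μ) (P.le k) (P.measurable_lyapunov v k) hC₀
  have i1 := integrable_of_measurable_of_bound (μ := μ) (P.le (k + 1))
    (P.measurable_lyapunov v (k + 1)) hC₁
  have i2 : Integrable (fun ω => increaseBound v ε m (e k ω) (lev k ω)) μ :=
    integrable_of_measurable_of_bound (P.le k) (P.measurable_increaseBound v k) hC₂
  have i3 : Integrable (fun ω => decreaseBound v ε c a m (e k ω) (lev k ω)) μ :=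
    integrable_of_measurable_of_bound (P.le k) (P.measurable_decreaseBound v k) hC₃
  have i4 : Integrable (fun ω => a (lev k ω) * e k ω) μ :=
    integrable_of_measurable_of_bound (P.le k)
      ((measurable_from_nat.comp (P.meas_lev k)).mul (P.meas_e k)) (C := C₄)
      (by simpa using hC₄)
  have i5 := P.err_int k
  have i3A : Integrable
      (fun ω => (A k).indicator (fun ω => decreaseBound v ε c a m (e k ω) (lev k ω)) ω) μ :=
    i3.indicator (P.meas_A k)
  have i02 : Integrable (fun ω => lyapunov v ε m (u k ω) (e k ω) (lev k ω)
      + increaseBound v ε m (e k ω) (lev k ω)) μ := i0.add i2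
  have i023 : Integrable (fun ω => lyapunov v ε m (u k ω) (e k ω) (lev k ω)
      + increaseBound v ε m (e k ω) (lev k ω)
      - (A k).indicator (fun ω => decreaseBound v ε c a m (e k ω) (lev k ω)) ω) μ := i02.sub i3A
  have i23 : Integrable (fun ω => increaseBound v ε m (e k ω) (lev k ω)
      - p * decreaseBound v ε c a m (e k ω) (lev k ω)) μ := i2.sub (i3.const_mul p)
  have hdec0 : ∀ ω ∈ B, 0 ≤ decreaseBound v ε c a m (e k ω) (lev k ω) := by
    intro ω hω
    have := weight_nonneg hv0.le m (lev k ω)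
    have := P.e_nonneg k ω
    have := ha0 (lev k ω)
    unfold decreaseBound
    split_ifs <;> positivity
  have step1 : ∫ ω in B, lyapunov v ε m (u (k + 1) ω) (e (k + 1) ω) (lev (k + 1) ω) ∂μ ≤
      ∫ ω in B, (lyapunov v ε m (u k ω) (e k ω) (lev k ω)
        + increaseBound v ε m (e k ω) (lev k ω)
        - (A k).indicator (fun ω => decreaseBound v ε c a m (e k ω) (lev k ω)) ω
        + err k ω) ∂μ := by
    refine setIntegral_mono_on i1.integrableOn
      (i023.add i5).integrableOn hB fun ω hω => ?_
    have h := P.lyapunov_step ha ha0 hc hε hv (heB ω hω)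
    by_cases hA : ω ∈ A k
    · rw [Set.indicator_of_mem hA] at h ⊢
      exact h
    · rw [Set.indicator_of_notMem hA] at h ⊢
      exact h
  have step2 : ∫ ω in B, (lyapunov v ε m (u k ω) (e k ω) (lev k ω)
        + increaseBound v ε m (e k ω) (lev k ω)
        - (A k).indicator (fun ω => decreaseBound v ε c a m (e k ω) (lev k ω)) ω
        + err k ω) ∂μ = ∫ ω in B, lyapunov v ε m (u k ω) (e k ω) (lev k ω) ∂μ
        + ∫ ω in B, increaseBound v ε m (e k ω) (lev k ω) ∂μ
        - ∫ ω in B, (A k).indicator (fun ω => decreaseBound v ε c a m (e k ω) (lev k ω)) ω ∂μ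
        + ∫ ω in B, err k ω ∂μ := by
    rw [integral_add i023.integrableOn i5.integrableOn,
      integral_sub i02.integrableOn i3A.integrableOn,
      integral_add i0.integrableOn i2.integrableOn]
  have step3 : p * ∫ ω in B, decreaseBound v ε c a m (e k ω) (lev k ω) ∂μ ≤
      ∫ ω in B, (A k).indicator (fun ω => decreaseBound v ε c a m (e k ω) (lev k ω)) ω ∂μ := by
    have h := P.good k (B.indicator fun ω => decreaseBound v ε c a m (e k ω) (lev k ω))
      ((P.measurable_decreaseBound v k).indicator hBF)
      (fun ω => Set.indicator_nonneg hdec0 ω)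
      ⟨C₃, fun ω => Set.indicator_apply_le' (fun _ => (le_abs_self _).trans (hC₃ ω))
        fun _ => (abs_nonneg _).trans (hC₃ ω)⟩
    rw [integral_indicator hB, setIntegral_indicator hB, Set.inter_comm] at h
    rwa [setIntegral_indicator (P.meas_A k)]
  have step4 := P.err_le k B hBF heB
  have step5 : ∫ ω in B, increaseBound v ε m (e k ω) (lev k ω) ∂μ
      - p * ∫ ω in B, decreaseBound v ε c a m (e k ω) (lev k ω) ∂μ
      + τ * ∫ ω in B, a (lev k ω) * e k ω ∂μ ≤ -(v * ε / 2) * μ.real B := by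
    rw [← integral_const_mul, ← integral_const_mul,
      ← integral_sub i2.integrableOn (i3.const_mul p).integrableOn,
      ← integral_add i23.integrableOn (i4.const_mul τ).integrableOn]
    calc _ ≤ ∫ _ω in B, -(v * ε / 2) ∂μ := by
          refine setIntegral_mono_on (i23.add (i4.const_mul τ)).integrableOn
            (integrable_const _) hB fun ω hω => ?_
          exact drift_le ha ha0 hc hp hε hv hτ0 hτ (heB ω hω) _
      _ = -(v * ε / 2) * μ.real B := by
          rw [setIntegral_const, smul_eq_mul, mul_comm]
  linarith

/-- At coarse levels `u` dominates `c a_m e`, four times the largest possible value of the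
subtracted term. -/
theorem ae_lyapunov_nonneg [IsProbabilityMeasure μ]
    (P : LevelProcess μ F a m c p τ ε u e err lev A) (ha : Antitone a)
    (ha0 : ∀ i, 0 < a i) (hc : 0 < c) (hp : 0 < p) (hε : 0 < ε) {v : ℝ}
    (hv : v = c * a m / 4 ^ (m + 1)) (k : ℕ) :
    ∀ᵐ ω ∂μ, 0 ≤ lyapunov v ε m (u k ω) (e k ω) (lev k ω) := by
  have hv0 : 0 < v := by rw [hv]; have := ha0 m; positivity
  have hvm : 4 * (v * 4 ^ m) = c * a m := by rw [hv, pow_succ]; field_simp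
  filter_upwards [P.mul_le_merit ha hc hp k] with ω hω
  have hεv : 0 ≤ ε * v * ((lev k ω - m : ℕ) : ℝ) := by positivity
  have he := P.e_nonneg k ω
  rcases le_or_gt (lev k ω) m with hl | hl
  · have h1 := hω hl
    have h2 := mul_le_mul_of_nonneg_right (weight_le hv0.le m (lev k ω)) he
    rw [← hvm] at h1
    have h3 : 0 ≤ v * 4 ^ m * e k ω := by positivity
    unfold lyapunov
    linarith
  · have e4 : weight v m (lev k ω) = 0 := by
      unfold weight
      rw [if_neg (by omega)]
    unfold lyapunov
    rw [e4]
    linarith [P.u_nonneg k ω]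

/-- The expected time until `ε`-stationarity is controlled by the initial merit value. -/
theorem sum_notYet_le [IsProbabilityMeasure μ]
    (P : LevelProcess μ F a m c p τ ε u e err lev A) (ha : Antitone a)
    (ha0 : ∀ i, 0 < a i) (hc : 0 < c) (hp : 3 / 4 ≤ p) (hε : 0 < ε) {v : ℝ}
    (hv : v = c * a m / 4 ^ (m + 1)) (hτ0 : 0 ≤ τ) (hτ : τ * a 0 ≤ v) {U : ℝ}
    (hU : ∀ ω, u 0 ω = U) (N : ℕ) :
    v * ε / 2 * ∑ k ∈ Finset.range N, μ.real (notYet e ε k) ≤ U := by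
  have hv0 : 0 < v := by rw [hv]; have := ha0 m; positivity
  have hp0 : 0 < p := by linarith
  have hint : ∀ k, Integrable (fun ω => lyapunov v ε m (u k ω) (e k ω) (lev k ω)) μ := fun k => by
    obtain ⟨C, hC⟩ := P.bounded_lyapunov v k
    exact integrable_of_measurable_of_bound (P.le k) (P.measurable_lyapunov v k) hC
  have key : ∀ N, v * ε / 2 * ∑ k ∈ Finset.range N, μ.real (notYet e ε k)
      + ∫ ω in notYet e ε N, lyapunov v ε m (u N ω) (e N ω) (lev N ω) ∂μ ≤ U := by
    intro N
    induction N with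
    | zero =>
      have hnn := P.ae_lyapunov_nonneg ha ha0 hc hp0 hε hv 0
      have h1 : ∫ ω in notYet e ε 0, lyapunov v ε m (u 0 ω) (e 0 ω) (lev 0 ω) ∂μ
          ≤ ∫ ω, lyapunov v ε m (u 0 ω) (e 0 ω) (lev 0 ω) ∂μ :=
        setIntegral_le_integral (hint 0) hnn
      have h2 : ∫ ω, lyapunov v ε m (u 0 ω) (e 0 ω) (lev 0 ω) ∂μ ≤ ∫ _ω, U ∂μ := by
        refine integral_mono (hint 0) (integrable_const _) fun ω => ?_
        have e2 : lev 0 ω - m = 0 := by have := P.lev_zero ω; omega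
        have := mul_nonneg (weight_nonneg hv0.le m (lev 0 ω)) (P.e_nonneg 0 ω)
        simp only [lyapunov, e2, hU]
        push_cast
        linarith
      simp only [integral_const, probReal_univ, smul_eq_mul, one_mul] at h2
      simpa using h1.trans h2
    | succ N ih =>
      have h1 := P.setIntegral_lyapunov_step ha ha0 hc hp hε hv hτ0 hτ N
      have hnn := P.ae_lyapunov_nonneg ha ha0 hc hp0 hε hv (N + 1)
      -- Paths that hit at time `N + 1` can be dropped since the Lyapunov function is almost surely
      -- nonnegative.
      have h2 : ∫ ω in notYet e ε (N + 1),
          lyapunov v ε m (u (N + 1) ω) (e (N + 1) ω) (lev (N + 1) ω) ∂μ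
          ≤ ∫ ω in notYet e ε N,
          lyapunov v ε m (u (N + 1) ω) (e (N + 1) ω) (lev (N + 1) ω) ∂μ :=
        setIntegral_mono_set (hint (N + 1)).integrableOn (ae_restrict_of_ae hnn)
          (Filter.Eventually.of_forall fun ω hω j hj => hω j (hj.trans (Nat.le_succ N)))
      rw [Finset.sum_range_succ, mul_add]
      linarith
  have h := key N
  have hnn : 0 ≤ ∫ ω in notYet e ε N, lyapunov v ε m (u N ω) (e N ω) (lev N ω) ∂μ :=
    integral_nonneg_of_ae (ae_restrict_of_ae (P.ae_lyapunov_nonneg ha ha0 hc hp0 hε hv N))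
  linarith

end LevelProcess

/-- The hitting time is at most the number of the times at which it has not occurred yet. -/
theorem iInf_le_tsum_notYet {T : Type*} (e : ℕ → T → ℝ) (ε : ℝ) (ω : T) :
    ⨅ (k : ℕ) (_ : e k ω < ε), (k : ENNReal)
      ≤ ∑' k, (LevelProcess.notYet e ε k).indicator (fun _ => (1 : ENNReal)) ω := by
  classical
  by_cases h : ∃ k, e k ω < ε
  · refine (iInf₂_le (Nat.find h) (Nat.find_spec h)).trans ?_
    refine le_trans ?_ (ENNReal.sum_le_tsum (Finset.range (Nat.find h)))
    have : ∀ k ∈ Finset.range (Nat.find h),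
        (LevelProcess.notYet e ε k).indicator (fun _ => (1 : ENNReal)) ω = 1 := by
      intro k hk
      refine Set.indicator_of_mem ?_ _
      intro j hj
      exact not_lt.1 (Nat.find_min h (hj.trans_lt (Finset.mem_range.1 hk)))
    rw [Finset.sum_congr rfl this]
    simp
  · push Not at h
    have : ∀ k, (LevelProcess.notYet e ε k).indicator (fun _ => (1 : ENNReal)) ω = 1 :=
      fun k => Set.indicator_of_mem (show ω ∈ LevelProcess.notYet e ε k from fun j _ => h j) _
    simp only [this]
    rw [ENNReal.tsum_const_eq_top_of_ne_zero one_ne_zero]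
    exact le_top

theorem LevelProcess.lintegral_hit_le {μ : Measure S} [IsProbabilityMeasure μ]
    {F : ℕ → MeasurableSpace S} {a : ℕ → ℝ} {m : ℕ}
    {c p τ ε : ℝ} {u e err : ℕ → S → ℝ} {lev : ℕ → S → ℕ} {A : ℕ → Set S}
    (P : LevelProcess μ F a m c p τ ε u e err lev A) (ha : Antitone a)
    (ha0 : ∀ i, 0 < a i) (hc : 0 < c) (hp : 3 / 4 ≤ p) (hε : 0 < ε) {v : ℝ}
    (hv : v = c * a m / 4 ^ (m + 1)) (hτ0 : 0 ≤ τ) (hτ : τ * a 0 ≤ v) {U : ℝ}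
    (hU : ∀ ω, u 0 ω = U) :
    ∫⁻ ω, ⨅ (k : ℕ) (_ : e k ω < ε), (k : ENNReal) ∂μ ≤ ENNReal.ofReal (2 * U / (v * ε)) := by
  have hv0 : 0 < v := by rw [hv]; have := ha0 m; positivity
  have hmeas : ∀ k, MeasurableSet (notYet e ε k) := fun k => P.le k _ (P.measurableSet_notYet k)
  calc _ ≤ ∫⁻ ω, ∑' k, (notYet e ε k).indicator (fun _ => (1 : ENNReal)) ω ∂μ :=
        lintegral_mono fun ω => iInf_le_tsum_notYet e ε ω
    _ = ∑' k, μ (notYet e ε k) := by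
        rw [lintegral_tsum fun k => (measurable_const.indicator (hmeas k)).aemeasurable]
        simp [lintegral_indicator (hmeas _)]
    _ ≤ ENNReal.ofReal (2 * U / (v * ε)) := by
        refine ENNReal.tsum_le_of_sum_range_le fun N => ?_
        have h := P.sum_notYet_le ha ha0 hc hp hε hv hτ0 hτ hU N
        have h1 : ∑ k ∈ Finset.range N, μ (notYet e ε k)
            = ENNReal.ofReal (∑ k ∈ Finset.range N, μ.real (notYet e ε k)) := by
          rw [ENNReal.ofReal_sum_of_nonneg fun _ _ => measureReal_nonneg]
          exact Finset.sum_congr rfl fun k _ => (ofReal_measureReal (measure_ne_top _ _)).symm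
        rw [h1]
        refine ENNReal.ofReal_le_ofReal ?_
        rw [le_div_iff₀ (by positivity)]
        linarith

end

end StochSQP

/-! ### Estimation errors off the accurate event. -/

namespace StochSQP

/-- A conditional second moment bound controls the mean of `|X|` on a set of small conditional
probability. -/
theorem setIntegral_compl_abs_le {S : Type*} {G : MeasurableSpace S} [mS : MeasurableSpace S]
    {μ : Measure S} [IsProbabilityMeasure μ] (hG : G ≤ mS) {X Z : S → ℝ} {B J : Set S}
    {κ q τ δ C : ℝ} (hB : MeasurableSet[G] B) (hJ : MeasurableSet J) (hκ : 0 < κ) (hτ : 0 < τ)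
    (hδ : 0 < δ) (hZ : Measurable[G] Z) (hZ0 : ∀ ω, 0 ≤ Z ω) (hZC : ∀ ω, Z ω ≤ C)
    (hZB : ∀ ω ∈ B, δ ≤ Z ω) (hX : MemLp X 2 μ)
    (hq : ∀ᵐ ω ∂μ, q ≤ (μ[J.indicator (fun _ => (1 : ℝ))|G]) ω)
    (hvar : ∀ᵐ ω ∂μ, (μ[fun ω => |X ω| ^ 2|G]) ω ≤ κ ^ 2 * Z ω ^ 2)
    (hτq : κ ^ 2 * (1 - q) ≤ τ ^ 2) :
    ∫ ω in B, Jᶜ.indicator (fun ω => |X ω|) ω ∂μ ≤ 2 * τ * ∫ ω in B, Z ω ∂μ := by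
  have hB' : MeasurableSet B := hG B hB
  -- Weight in `2|X| ≤ b X² / Z + Z / b` on the complement of `J`. Conditional expectations turn the
  -- right side into at most `(b κ² + (1 - q) / b) Z`, that is `2 τ Z` plus at most `τ Z`. The lower
  -- bound `δ` keeps `b / Z` bounded on `B`.
  set b : ℝ := 2 * τ / κ ^ 2 with hb
  have hb0 : 0 < b := by positivity
  have hXsq : Integrable (fun ω => |X ω| ^ 2) μ := by
    simpa only [sq_abs] using hX.integrable_sq
  have hXabs : Integrable (fun ω => |X ω|) μ := (hX.integrable one_le_two).abs
  have hJ1 : Integrable (J.indicator fun _ => (1 : ℝ)) μ := (integrable_const _).indicator hJ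
  have hZint : Integrable Z μ := integrable_of_measurable_of_bound hG hZ (C := C)
    fun ω => by rw [abs_of_nonneg (hZ0 ω)]; exact hZC ω
  set W₁ : S → ℝ := B.indicator fun ω => b / Z ω with hW₁
  set W₂ : S → ℝ := B.indicator fun ω => Z ω / b with hW₂
  have m₁ : Measurable[G] W₁ := (measurable_const.div hZ).indicator hB
  have m₂ : Measurable[G] W₂ := (hZ.div_const b).indicator hB
  have n₁ : ∀ ω, 0 ≤ W₁ ω := fun ω => Set.indicator_nonneg (fun ω _ => div_nonneg hb0.le (hZ0 ω)) ω
  have n₂ : ∀ ω, 0 ≤ W₂ ω := fun ω => Set.indicator_nonneg (fun ω _ => div_nonneg (hZ0 ω) hb0.le) ω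
  have hC0 : ∀ ω, 0 ≤ C / b := fun ω => div_nonneg ((hZ0 ω).trans (hZC ω)) hb0.le
  have b₁ : ∀ ω, W₁ ω ≤ b / δ := fun ω => Set.indicator_apply_le'
    (fun hω => div_le_div_of_nonneg_left hb0.le hδ (hZB ω hω)) fun _ => by positivity
  have b₂ : ∀ ω, W₂ ω ≤ C / b := fun ω => Set.indicator_apply_le'
    (fun _ => div_le_div_of_nonneg_right (hZC ω) hb0.le) fun _ => hC0 ω
  have iZB : Integrable (B.indicator Z) μ := hZint.indicator hB'
  have hW₂eq : ∀ ω, W₂ ω = b⁻¹ * B.indicator Z ω := by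
    intro ω
    by_cases hω : ω ∈ B
    · simp only [hW₂, Set.indicator_of_mem hω]; field_simp
    · simp only [hW₂, Set.indicator_of_notMem hω]; simp
  have hW₁eq : ∀ ω, W₁ ω * (-(κ ^ 2 * Z ω ^ 2)) = -(2 * τ) * B.indicator Z ω := by
    intro ω
    by_cases hω : ω ∈ B
    · have : 0 < Z ω := hδ.trans_le (hZB ω hω)
      simp only [hW₁, Set.indicator_of_mem hω, hb]; field_simp
    · simp only [hW₁, Set.indicator_of_notMem hω]; simp
  have iW₂ : Integrable W₂ μ := by
    simpa only [funext hW₂eq] using iZB.const_mul b⁻¹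
  have h1 : ∫ ω, W₁ ω * (-(κ ^ 2 * Z ω ^ 2)) ∂μ ≤ ∫ ω, W₁ ω * (-(|X ω| ^ 2)) ∂μ := by
    refine integral_mul_le_integral_mul_of_le_condExp hG m₁ n₁ b₁ hXsq.neg ?_ ?_
    · simp only [hW₁eq]
      exact iZB.const_mul _
    · have := condExp_neg (fun ω => |X ω| ^ 2) G (μ := μ)
      filter_upwards [this, hvar] with ω e1 e2
      have e3 : (μ[fun ω => -|X ω| ^ 2|G]) ω = -(μ[fun ω => |X ω| ^ 2|G]) ω := e1
      rw [e3]
      linarith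
  have h2 : ∫ ω, W₂ ω * q ∂μ ≤ ∫ ω, W₂ ω * J.indicator (fun _ => (1 : ℝ)) ω ∂μ :=
    integral_mul_le_integral_mul_of_le_condExp hG m₂ n₂ b₂ hJ1 (iW₂.mul_const q) hq
  have iWX : Integrable (fun ω => W₁ ω * |X ω| ^ 2) μ :=
    hXsq.bdd_mul (m₁.mono hG le_rfl).aestronglyMeasurable (c := b / δ) (ae_of_all _ fun ω => by
      rw [Real.norm_of_nonneg (n₁ ω)]; exact b₁ ω)
  have iWJ : Integrable (fun ω => W₂ ω * J.indicator (fun _ => (1 : ℝ)) ω) μ :=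
    hJ1.bdd_mul (m₂.mono hG le_rfl).aestronglyMeasurable (c := C / b) (ae_of_all _ fun ω => by
      rw [Real.norm_of_nonneg (n₂ ω)]; exact b₂ ω)
  have iWJ' : Integrable (fun ω => W₂ ω - W₂ ω * J.indicator (fun _ => (1 : ℝ)) ω) μ := iW₂.sub iWJ
  have h3 : 2 * ∫ ω in B, Jᶜ.indicator (fun ω => |X ω|) ω ∂μ ≤
      ∫ ω, (W₁ ω * |X ω| ^ 2 + (W₂ ω - W₂ ω * J.indicator (fun _ => (1 : ℝ)) ω)) ∂μ := by
    rw [← integral_const_mul, ← integral_indicator hB']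
    refine integral_mono (((hXabs.indicator hJ.compl).const_mul 2).indicator hB')
      (iWX.add iWJ') fun ω => ?_
    show B.indicator (fun ω => 2 * Jᶜ.indicator (fun ω => |X ω|) ω) ω ≤
      W₁ ω * |X ω| ^ 2 + (W₂ ω - W₂ ω * J.indicator (fun _ => (1 : ℝ)) ω)
    by_cases hω : ω ∈ B
    · by_cases hωJ : ω ∈ J
      · rw [Set.indicator_of_mem hω, Set.indicator_of_notMem (by simpa using hωJ),
          Set.indicator_of_mem hωJ]
        have := mul_nonneg (n₁ ω) (sq_nonneg |X ω|)
        linarith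
      · have hz : 0 < Z ω := hδ.trans_le (hZB ω hω)
        rw [Set.indicator_of_mem hω, Set.indicator_of_mem (by simpa using hωJ),
          Set.indicator_of_notMem hωJ, hW₁, hW₂, Set.indicator_of_mem hω,
          Set.indicator_of_mem hω]
        -- The arithmetic-geometric inequality written as a perfect square.
        have e : b / Z ω * |X ω| ^ 2 + (Z ω / b - Z ω / b * 0) - 2 * |X ω|
            = (b * |X ω| - Z ω) ^ 2 / (b * Z ω) := by
          field_simp
          ring
        have : 0 ≤ (b * |X ω| - Z ω) ^ 2 / (b * Z ω) := by positivity
        linarith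
    · simp [hW₁, hW₂, Set.indicator_of_notMem hω]
  rw [integral_add iWX iWJ', integral_sub iW₂ iWJ] at h3
  simp only [hW₁eq, mul_neg, integral_neg] at h1
  rw [integral_const_mul, integral_indicator hB'] at h1
  rw [integral_mul_const] at h2
  have h4 : ∫ ω, W₂ ω ∂μ = b⁻¹ * ∫ ω in B, Z ω ∂μ := by
    simp only [hW₂eq]
    rw [integral_const_mul, integral_indicator hB']
  have hI : 0 ≤ ∫ ω in B, Z ω ∂μ := integral_nonneg hZ0
  have h5 : b⁻¹ * (1 - q) ≤ τ := by
    rw [hb, inv_div, div_mul_eq_mul_div, div_le_iff₀ (by positivity)]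
    nlinarith [sq_nonneg τ]
  have h6 := mul_le_mul_of_nonneg_right h5 hI
  rw [h4] at h2 h3
  nlinarith

theorem measurableSet_le_of_measurable {S : Type*} {F : MeasurableSpace S} {f g : S → ℝ}
    (hf : Measurable[F] f) (hg : Measurable[F] g) : MeasurableSet[F] {ω | f ω ≤ g ω} := by
  have hset : {ω | f ω ≤ g ω} = (fun ω => f ω - g ω) ⁻¹' Set.Iic 0 := by
    ext ω; simp
  rw [hset]
  exact (hf.sub hg) measurableSet_Iic

/-! ### Step-size levels and measurability along a run. -/

namespace Run

variable {n m₁ m₂ : ℕ} {Q : Problem n m₁ m₂} {A : Params} {x₀ : E n} {ρ₀ p₀ : ℝ}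
  {S : Type*} {F : MeasurableSpace S} [mS : MeasurableSpace S] (R : Run Q A x₀ ρ₀ p₀ S)

/-- The model reduction at iteration `k` for the penalty parameter `ρ`. -/
noncomputable def reduction (ρ : ℝ) (k : ℕ) (ω : S) : ℝ :=
  -inner ℝ (R.g k ω) (R.d k ω) + ρ * Q.deltaPhi (R.x k ω) (A.sigma Q (R.x k ω))

/-- The event that iteration `k` is successful, for the penalty parameter `ρ`. -/
def successEvent (ρ : ℝ) (k : ℕ) : Set S :=
  {ω | A.θ * R.α k ω * R.reduction ρ k ω ≤
      (R.f0 k ω + ρ * Q.phi (R.x k ω))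
        - (R.fs k ω + ρ * Q.phi (R.x k ω + R.α k ω • R.d k ω))}

open Classical in
/-- The number of net reductions of the step size from its maximal value. -/
noncomputable def level (ρ : ℝ) : ℕ → S → ℕ
  | 0, _ => A.j₀
  | k + 1, ω => if ω ∈ R.successEvent ρ k then level ρ k ω - 1 else level ρ k ω + 1

/-- A larger estimate would raise the threshold by at least `ζ_c > 0`, against its constancy. -/
theorem norm_g_le (hζ : ∀ k ω, R.ζ k ω = A.ζ₀) (k : ℕ) (ω : S) : ‖R.g k ω‖ ≤ A.ζ₀ := by
  by_contra hcon
  have h1 := (R.ζ_large k ω (by rw [hζ]; exact not_le.1 hcon)).1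
  rw [hζ, hζ] at h1
  linarith [le_max_left (A.ζ₀ + A.ζc) ‖R.g k ω‖, A.ζc_pos]

/-- The model reduction dominates the quadratic term for the initial penalty parameter. -/
def ReductionBound : Prop :=
  ∀ k ω, 1 / 2 * quad (R.H k ω) (R.d k ω) ≤ R.reduction ρ₀ k ω

variable {R}

theorem rho_eq (hR : R.ReductionBound) (k : ℕ) (ω : S) : R.ρ k ω = ρ₀ := by
  induction k with
  | zero => exact R.ρ_zero ω
  | succ k ih => rw [R.ρ_keep k ω (by rw [ih]; exact hR k ω), ih]

theorem step_of_mem (hR : R.ReductionBound) {k : ℕ} {ω : S} (h : ω ∈ R.successEvent ρ₀ k) :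
    R.x (k + 1) ω = R.x k ω + R.α k ω • R.d k ω ∧ R.α (k + 1) ω = min (A.γ * R.α k ω) A.αmax :=
  R.step_success k ω (by rw [rho_eq hR (k + 1) ω]; exact h)

theorem step_of_notMem (hR : R.ReductionBound) {k : ℕ} {ω : S} (h : ω ∉ R.successEvent ρ₀ k) :
    R.x (k + 1) ω = R.x k ω ∧ R.α (k + 1) ω = A.γ⁻¹ * R.α k ω :=
  R.step_fail k ω (by rw [rho_eq hR (k + 1) ω]; exact h)

/-- Truncated subtraction at level zero matches the cap `αmax`. -/
theorem alpha_eq (hR : R.ReductionBound) (k : ℕ) (ω : S) :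
    R.α k ω = A.αmax / A.γ ^ R.level ρ₀ k ω := by
  have hγ0 : 0 < A.γ := one_pos.trans A.γ_gt
  induction k with
  | zero => exact R.α_zero ω
  | succ k ih =>
    by_cases h : ω ∈ R.successEvent ρ₀ k
    · rw [(step_of_mem hR h).2, level, if_pos h, ih]
      cases R.level ρ₀ k ω with
      | zero =>
        simp only [pow_zero, div_one, Nat.zero_sub]
        exact min_eq_right (le_mul_of_one_le_left A.αmax_pos.le A.γ_gt.le)
      | succ i =>
        have : A.γ * (A.αmax / A.γ ^ (i + 1)) = A.αmax / A.γ ^ i := by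
          rw [pow_succ]; field_simp
        rw [this, Nat.add_sub_cancel]
        exact min_eq_left (div_le_self A.αmax_pos.le (one_le_pow₀ A.γ_gt.le))
    · rw [(step_of_notMem hR h).2, level, if_neg h, ih, pow_succ]
      field_simp

theorem alpha_pos (hR : R.ReductionBound) (k : ℕ) (ω : S) : 0 < R.α k ω := by
  rw [alpha_eq hR]
  exact div_pos A.αmax_pos (pow_pos (one_pos.trans A.γ_gt) _)

theorem alpha_le (hR : R.ReductionBound) (k : ℕ) (ω : S) : R.α k ω ≤ A.αmax := by
  rw [alpha_eq hR]
  exact div_le_self A.αmax_pos.le (one_le_pow₀ A.γ_gt.le)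

section Filtration

variable (R)

theorem past_le_pastHalf (k : ℕ) : R.past k ≤ R.pastHalf k := le_sup_left

theorem past_mono : Monotone R.past := by
  intro k l hkl
  refine iSup_le fun i => ?_
  exact le_iSup (fun i : Fin l => MeasurableSpace.comap (R.g i) inferInstance ⊔
    MeasurableSpace.comap (R.f0 i) inferInstance ⊔ MeasurableSpace.comap (R.fs i) inferInstance)
    (Fin.castLE hkl i)

theorem comap_le_past_succ (k : ℕ) : MeasurableSpace.comap (R.g k) inferInstance ⊔
    MeasurableSpace.comap (R.f0 k) inferInstance ⊔ MeasurableSpace.comap (R.fs k) inferInstance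
    ≤ R.past (k + 1) :=
  le_iSup (fun i : Fin (k + 1) => MeasurableSpace.comap (R.g i) inferInstance ⊔
    MeasurableSpace.comap (R.f0 i) inferInstance ⊔ MeasurableSpace.comap (R.fs i) inferInstance)
    (Fin.last k)

theorem pastHalf_le_past_succ (k : ℕ) : R.pastHalf k ≤ R.past (k + 1) :=
  sup_le (R.past_mono k.le_succ)
    ((le_sup_left.trans le_sup_left).trans (R.comap_le_past_succ k))

theorem past_le (k : ℕ) : R.past k ≤ mS :=
  iSup_le fun i => sup_le (sup_le (R.meas_g i).comap_le (R.meas_f0 i).comap_le)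
    (R.meas_fs i).comap_le

theorem pastHalf_le (k : ℕ) : R.pastHalf k ≤ mS :=
  (R.pastHalf_le_past_succ k).trans (R.past_le _)

theorem measurable_g_pastHalf (k : ℕ) : Measurable[R.pastHalf k] (R.g k) :=
  measurable_iff_comap_le.2 le_sup_right

theorem measurable_f0_past (k : ℕ) : Measurable[R.past (k + 1)] (R.f0 k) :=
  measurable_iff_comap_le.2 ((le_sup_right.trans le_sup_left).trans (R.comap_le_past_succ k))

theorem measurable_fs_past (k : ℕ) : Measurable[R.past (k + 1)] (R.fs k) :=
  measurable_iff_comap_le.2 (le_sup_right.trans (R.comap_le_past_succ k))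

end Filtration

variable {Ω K : Set (E n)} {Lf : NNReal} {Lh : Fin m₁ → NNReal} {Lc : Fin m₂ → NNReal}

theorem measurable_alpha_of_level (hR : R.ReductionBound) {k : ℕ}
    (h : Measurable[F] (R.level ρ₀ k)) : Measurable[F] (R.α k) := by
  have : R.α k = (fun i : ℕ => A.αmax / A.γ ^ i) ∘ R.level ρ₀ k := funext fun ω => alpha_eq hR k ω
  rw [this]
  exact measurable_from_nat.comp h

theorem measurable_trial {k : ℕ} (hx : Measurable[F] (R.x k))
    (hα : Measurable[F] (R.α k)) (hd : Measurable[F] (R.d k)) :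
    Measurable[F] fun ω => R.x k ω + R.α k ω • R.d k ω :=
  hx.add (hα.smul hd)

theorem measurableSet_successEvent (hΩ : Q.RegularOn Ω Lf Lh Lc) (hA : R.Adapted)
    (hR : R.ReductionBound) {k : ℕ} (hx : Measurable[R.past k] (R.x k))
    (hl : Measurable[R.past k] (R.level ρ₀ k)) :
    MeasurableSet[R.past (k + 1)] (R.successEvent ρ₀ k) := by
  have hx' : Measurable[R.past (k + 1)] (R.x k) := hx.mono (R.past_mono k.le_succ) le_rfl
  have hα : Measurable[R.past (k + 1)] (R.α k) :=
    measurable_alpha_of_level hR (hl.mono (R.past_mono k.le_succ) le_rfl)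
  have hd : Measurable[R.past (k + 1)] (R.d k) := (hA k).mono (R.pastHalf_le_past_succ k) le_rfl
  have hg : Measurable[R.past (k + 1)] (R.g k) :=
    (R.measurable_g_pastHalf k).mono (R.pastHalf_le_past_succ k) le_rfl
  have hφ : Measurable Q.phi := hΩ.continuous_phi.measurable
  have hΔ : Measurable fun x => Q.deltaPhi x (A.sigma Q x) := hφ.sub (hΩ.measurable_kap A)
  have hred : Measurable[R.past (k + 1)] (R.reduction ρ₀ k) :=
    (hg.inner hd).neg.add ((hΔ.comp hx').const_mul ρ₀)
  refine measurableSet_le_of_measurable ((hα.const_mul A.θ).mul hred) ?_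
  exact ((R.measurable_f0_past k).add ((hφ.comp hx').const_mul ρ₀)).sub
    ((R.measurable_fs_past k).add ((hφ.comp (measurable_trial hx' hα hd)).const_mul ρ₀))

/-- Iterate and level must be treated together: success at time `k` depends on both, and decides
both at time `k + 1`. -/
theorem measurable_x_level (hΩ : Q.RegularOn Ω Lf Lh Lc) (hA : R.Adapted)
    (hR : R.ReductionBound) (k : ℕ) :
    Measurable[R.past k] (R.x k) ∧ Measurable[R.past k] (R.level ρ₀ k) := by
  induction k with
  | zero =>
    constructor
    · rw [funext R.x_zero]; exact measurable_const
    · exact measurable_const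
  | succ k ih =>
    classical
    obtain ⟨hx, hl⟩ := ih
    have hS := measurableSet_successEvent hΩ hA hR hx hl
    have hx' : Measurable[R.past (k + 1)] (R.x k) := hx.mono (R.past_mono k.le_succ) le_rfl
    have hl' : Measurable[R.past (k + 1)] (R.level ρ₀ k) := hl.mono (R.past_mono k.le_succ) le_rfl
    have hα := measurable_alpha_of_level hR hl'
    have hd : Measurable[R.past (k + 1)] (R.d k) := (hA k).mono (R.pastHalf_le_past_succ k) le_rfl
    constructor
    · have : R.x (k + 1) = fun ω => if ω ∈ R.successEvent ρ₀ k then R.x k ω + R.α k ω • R.d k ω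
          else R.x k ω := by
        funext ω
        split_ifs with h
        · exact (step_of_mem hR h).1
        · exact (step_of_notMem hR h).1
      rw [this]
      exact Measurable.ite hS (measurable_trial hx' hα hd) hx'
    · have : R.level ρ₀ (k + 1) = fun ω => if ω ∈ R.successEvent ρ₀ k then R.level ρ₀ k ω - 1
          else R.level ρ₀ k ω + 1 := by
        funext ω
        rw [level]
      rw [this]
      exact Measurable.ite hS ((measurable_from_nat (f := fun i : ℕ => i - 1)).comp hl')
        ((measurable_from_nat (f := fun i : ℕ => i + 1)).comp hl')

end Run

end StochSQP

/-! ### The algorithm as a level process. -/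

namespace StochSQP

namespace Run

variable {n m₁ m₂ : ℕ} {Q : Problem n m₁ m₂} {A : Params} {x₀ : E n} {ρ₀ p₀ : ℝ}
  {S : Type*} [mS : MeasurableSpace S] {R : Run Q A x₀ ρ₀ p₀ S}
  {Ω K : Set (E n)} {Lf : NNReal} {Lh : Fin m₁ → NNReal} {Lc : Fin m₂ → NNReal}
  {ξ MH κg εf : ℝ}

theorem reduction_ge (hH : R.HessianBounds ξ MH) (hR : R.ReductionBound) (k : ℕ) (ω : S) :
    ξ * ‖R.d k ω‖ ^ 2 ≤ R.reduction ρ₀ k ω := by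
  have h1 := hR k ω
  have h2 := (hH k ω (R.d k ω)).1
  linarith

theorem linPhi_d_le (k : ℕ) (ω : S) :
    Q.linPhi (R.x k ω) (R.d k ω) ≤ Q.kap (R.x k ω) (A.sigma Q (R.x k ω)) :=
  ((Problem.mem_qpFeasible_iff _ _ (Problem.kap_nonneg _ _)).1 (R.d_mem k ω)).1

/-- With accurate estimates and a small step size the iteration is successful. -/
theorem mem_successEvent (hΩ : Q.RegularOn Ω Lf Lh Lc) (hst : R.StaysIn K Ω)
    (hH : R.HessianBounds ξ MH) (hR : R.ReductionBound) (hρ : 0 ≤ ρ₀) {k : ℕ} {ω : S}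
    (hI : ω ∈ R.gradEvent κg k) (hJ : ω ∈ R.funEvent εf k) (hα1 : R.α k ω ≤ 1)
    (hα : R.α k ω * (κg + Lf + 2 * εf + ρ₀ * Lhc Lh Lc) ≤ (1 - A.θ) * ξ) :
    ω ∈ R.successEvent ρ₀ k := by
  have hα0 := alpha_pos hR k ω
  have h1 := hΩ.Psi_add_smul_le hρ hα0.le hα1 (hst.2 k ω) (linPhi_d_le k ω)
  have hred := reduction_ge hH hR k ω
  obtain ⟨hJ1, hJ2⟩ := hJ
  have h2 := (abs_le.1 hJ1).1
  have h3 := (abs_le.1 hJ2).2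
  have h4 : inner ℝ (gradient Q.f (R.x k ω)) (R.d k ω) ≤
      inner ℝ (R.g k ω) (R.d k ω) + κg * R.α k ω * ‖R.d k ω‖ ^ 2 := by
    have h5 := (abs_le.1 (abs_real_inner_le_norm (R.g k ω - gradient Q.f (R.x k ω)) (R.d k ω))).1
    rw [inner_sub_left] at h5
    have h6 := mul_le_mul_of_nonneg_right (show _ ≤ _ from hI) (norm_nonneg (R.d k ω))
    nlinarith
  have h5 := mul_le_mul_of_nonneg_left h4 hα0.le
  have h6 : R.α k ω * (R.α k ω * (κg + Lf + 2 * εf + ρ₀ * Lhc Lh Lc) * ‖R.d k ω‖ ^ 2)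
      ≤ R.α k ω * ((1 - A.θ) * ξ * ‖R.d k ω‖ ^ 2) := by gcongr
  have h7 : R.α k ω * ((1 - A.θ) * (ξ * ‖R.d k ω‖ ^ 2))
      ≤ R.α k ω * ((1 - A.θ) * R.reduction ρ₀ k ω) := by
    have : 0 ≤ 1 - A.θ := by linarith [A.θ_lt]
    gcongr
  show A.θ * R.α k ω * R.reduction ρ₀ k ω ≤ _
  rw [Problem.Psi, Problem.Psi] at h1
  unfold reduction at h7 ⊢
  nlinarith

theorem Psi_succ_le (hH : R.HessianBounds ξ MH)
    (hR : R.ReductionBound) {k : ℕ} {ω : S} (hs : ω ∈ R.successEvent ρ₀ k) :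
    Q.Psi ρ₀ (R.x (k + 1) ω) ≤ Q.Psi ρ₀ (R.x k ω) - A.θ * R.α k ω * (ξ * ‖R.d k ω‖ ^ 2) +
      (|R.f0 k ω - Q.f (R.x k ω)| + |R.fs k ω - Q.f (R.x k ω + R.α k ω • R.d k ω)|) := by
  have h1 : A.θ * R.α k ω * R.reduction ρ₀ k ω ≤ (R.f0 k ω + ρ₀ * Q.phi (R.x k ω))
        - (R.fs k ω + ρ₀ * Q.phi (R.x k ω + R.α k ω • R.d k ω)) := hs
  have h2 := mul_le_mul_of_nonneg_left (reduction_ge hH hR k ω)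
    (mul_nonneg A.θ_pos.le (alpha_pos hR k ω).le)
  rw [(step_of_mem hR hs).1, Problem.Psi, Problem.Psi]
  have h3 := le_abs_self (R.f0 k ω - Q.f (R.x k ω))
  have h4 := neg_le_abs (R.fs k ω - Q.f (R.x k ω + R.α k ω • R.d k ω))
  linarith

/-- Both estimation errors together amount to at most `2 εf αmax < ξ θ / 2` times `α ‖d‖²`, half of
the decrease certified by the acceptance test. -/
theorem Psi_succ_le_of_mem_funEvent (hH : R.HessianBounds ξ MH) (hξ : 0 < ξ)
    (hεf' : εf < ξ * A.θ / (4 * A.αmax))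
    (hR : R.ReductionBound) {k : ℕ} {ω : S} (hs : ω ∈ R.successEvent ρ₀ k)
    (hJ : ω ∈ R.funEvent εf k) :
    Q.Psi ρ₀ (R.x (k + 1) ω) ≤ Q.Psi ρ₀ (R.x k ω)
      - A.θ * ξ / 2 * (R.α k ω * ‖R.d k ω‖ ^ 2) := by
  have h1 := Psi_succ_le hH hR hs
  obtain ⟨hJ1, hJ2⟩ := hJ
  have hα0 := alpha_pos hR k ω
  have h2 : εf * R.α k ω ≤ ξ * A.θ / 4 := by
    have hm := A.αmax_pos
    have hθ := A.θ_pos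
    calc εf * R.α k ω ≤ ξ * A.θ / (4 * A.αmax) * R.α k ω := by gcongr
      _ ≤ ξ * A.θ / (4 * A.αmax) * A.αmax := by gcongr; exact alpha_le hR k ω
      _ = ξ * A.θ / 4 := by field_simp
  have h3 := mul_le_mul_of_nonneg_right h2
    (by positivity : 0 ≤ R.α k ω * ‖R.d k ω‖ ^ 2)
  linarith

/-- The error of the function estimates off the event that they are accurate. -/
noncomputable def estimateError (R : Run Q A x₀ ρ₀ p₀ S) (εf : ℝ) (k : ℕ) : S → ℝ :=
  fun ω => (R.funEvent εf k)ᶜ.indicator (fun ω => |R.f0 k ω - Q.f (R.x k ω)|) ω +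
    (R.funEvent εf k)ᶜ.indicator
      (fun ω => |R.fs k ω - Q.f (R.x k ω + R.α k ω • R.d k ω)|) ω

theorem estimateError_nonneg (k : ℕ) (ω : S) : 0 ≤ R.estimateError εf k ω :=
  add_nonneg (Set.indicator_nonneg (fun _ _ => abs_nonneg _) ω)
    (Set.indicator_nonneg (fun _ _ => abs_nonneg _) ω)

theorem measurableSet_gradEvent (hΩ : Q.RegularOn Ω Lf Lh Lc) (hA : R.Adapted)
    (hR : R.ReductionBound) (k : ℕ) : MeasurableSet[R.pastHalf k] (R.gradEvent κg k) := by
  obtain ⟨hx, hl⟩ := measurable_x_level hΩ hA hR k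
  have hx' := hx.mono (R.past_le_pastHalf k) le_rfl
  have hα := (measurable_alpha_of_level hR hl).mono (R.past_le_pastHalf k) le_rfl
  have hgr : Measurable (gradient Q.f) := (continuous_gradient hΩ.smooth_f).measurable
  exact measurableSet_le_of_measurable
    (measurable_norm.comp ((R.measurable_g_pastHalf k).sub (hgr.comp hx')))
    ((hα.const_mul κg).mul (measurable_norm.comp (hA k)))

theorem measurableSet_funEvent (hΩ : Q.RegularOn Ω Lf Lh Lc) (hA : R.Adapted)
    (hR : R.ReductionBound) (k : ℕ) : MeasurableSet (R.funEvent εf k) := by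
  obtain ⟨hx, hl⟩ := measurable_x_level hΩ hA hR k
  have hx' := hx.mono (R.past_le k) le_rfl
  have hα := (measurable_alpha_of_level hR hl).mono (R.past_le k) le_rfl
  have hd := (hA k).mono (R.pastHalf_le k) le_rfl
  have hf : Measurable Q.f := hΩ.smooth_f.continuous.measurable
  have hb : Measurable fun ω => εf * R.α k ω ^ 2 * ‖R.d k ω‖ ^ 2 :=
    ((hα.pow_const 2).const_mul εf).mul (hd.norm.pow_const 2)
  exact (measurableSet_le_of_measurable ((R.meas_f0 k).sub (hf.comp hx')).norm hb).inter
    (measurableSet_le_of_measurable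
      ((R.meas_fs k).sub (hf.comp (measurable_trial hx' hα hd))).norm hb)

/-- The two accuracies are conditioned in turn: the weight restricted to the gradient event is known
once `g_k` is, so `pf` applies to it, and then `pg` applies given the past. -/
theorem mul_integral_le_setIntegral_accurate {μ : Measure S} [IsProbabilityMeasure μ]
    (hΩ : Q.RegularOn Ω Lf Lh Lc) (hA : R.Adapted)
    (hR : R.ReductionBound) {pf pg : ℝ} (hpf : 0 ≤ pf) (hpg : ∀ k ω, R.pg k ω = pg)
    (hG : R.GradAccurate μ κg) (hF : R.FunAccurate μ εf pf) {k : ℕ} {W : S → ℝ}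
    (hW : Measurable[R.past k] W) (hW0 : ∀ ω, 0 ≤ W ω) {C : ℝ} (hC : ∀ ω, W ω ≤ C) :
    pf * pg * ∫ ω, W ω ∂μ ≤ ∫ ω in R.gradEvent κg k ∩ R.funEvent εf k, W ω ∂μ := by
  have hI : MeasurableSet[R.pastHalf k] (R.gradEvent κg k) := measurableSet_gradEvent hΩ hA hR k
  have hI' : MeasurableSet (R.gradEvent κg k) := R.pastHalf_le k _ hI
  have hJ : MeasurableSet (R.funEvent εf k) := measurableSet_funEvent hΩ hA hR k
  have hWi : Integrable W μ := integrable_of_measurable_of_bound (R.past_le k) hW (C := C)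
    fun ω => by rw [abs_of_nonneg (hW0 ω)]; exact hC ω
  have h1 : ∫ ω, W ω * pg ∂μ ≤
      ∫ ω, W ω * (R.gradEvent κg k).indicator (fun _ => (1 : ℝ)) ω ∂μ := by
    refine integral_mul_le_integral_mul_of_le_condExp (R.past_le k) hW hW0 hC
      ((integrable_const _).indicator hI') (hWi.mul_const pg) ?_
    simpa only [hpg] using hG k
  have hWI : Measurable[R.pastHalf k] ((R.gradEvent κg k).indicator W) :=
    (hW.mono (R.past_le_pastHalf k) le_rfl).indicator hI
  have h2 : ∫ ω, (R.gradEvent κg k).indicator W ω * pf ∂μ ≤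
      ∫ ω, (R.gradEvent κg k).indicator W ω *
        (R.funEvent εf k).indicator (fun _ => (1 : ℝ)) ω ∂μ :=
    integral_mul_le_integral_mul_of_le_condExp (R.pastHalf_le k) hWI
      (fun ω => Set.indicator_nonneg (fun ω _ => hW0 ω) ω)
      (fun ω => (Set.indicator_le_self' (fun _ _ => hW0 _) ω).trans (hC ω))
      ((integrable_const _).indicator hJ) ((hWi.indicator hI').mul_const pf) (hF k)
  have e1 : ∀ (T : Set S) (V : S → ℝ) (ω : S),
      V ω * T.indicator (fun _ => (1 : ℝ)) ω = T.indicator V ω := by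
    intro T V ω
    by_cases h : ω ∈ T
    · simp [h]
    · simp [h]
  simp only [e1] at h1 h2
  rw [integral_mul_const, integral_indicator hI'] at h1
  rw [integral_mul_const, integral_indicator hI', integral_indicator hJ,
    setIntegral_indicator hI', Set.inter_comm] at h2
  have h3 := mul_le_mul_of_nonneg_left h1 hpf
  linarith

/-- The error rate `4 τ` collects `2 τ` from each of the two function estimates. -/
theorem levelProcess {μ : Measure S} [IsProbabilityMeasure μ]
    (hΩ : Q.RegularOn Ω Lf Lh Lc) (hKc : IsCompact K) (hKΩ : K ⊆ Ω) (hξ : 0 < ξ)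
    (hεf' : εf < ξ * A.θ / (4 * A.αmax)) (hρ : 0 ≤ ρ₀) {Ce : ℝ} (hCe : 0 < Ce)
    (hCeK : ∀ k, ∀ ω ∈ R.gradEvent κg k,
      Q.phi (R.x k ω) ^ 2 + Q.chi A.βl (R.x k ω) ^ 2 ≤ Ce * ‖R.d k ω‖ ^ 2)
    {m : ℕ} (hm0 : A.j₀ ≤ m) (hm1 : A.αmax / A.γ ^ m ≤ 1)
    (hκ : 0 ≤ κg + Lf + 2 * εf + ρ₀ * Lhc Lh Lc)
    (hm : A.αmax / A.γ ^ m * (κg + Lf + 2 * εf + ρ₀ * Lhc Lh Lc) ≤ (1 - A.θ) * ξ)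
    (hA : R.Adapted) (hst : R.StaysIn K Ω) (hH : R.HessianBounds ξ MH) (hR : R.ReductionBound)
    {κf pf pg τ : ℝ} (hκf : 0 < κf) (hτ : 0 < τ) (hpf : 0 ≤ pf) (hτf : κf ^ 2 * (1 - pf) ≤ τ ^ 2)
    (hpg : ∀ k ω, R.pg k ω = pg)
    (hG : R.GradAccurate μ κg) (hF : R.FunAccurate μ εf pf) (hV : R.VarianceCond μ κf)
    {Ψmin : ℝ} (hΨ : ∀ x ∈ Ω, Ψmin ≤ Q.Psi ρ₀ x) {ε : ℝ} (hε : 0 < ε) :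
    LevelProcess μ R.past (fun i => A.αmax / A.γ ^ i) m (A.θ * ξ / (2 * Ce)) (pf * pg) (4 * τ) ε
      (fun k ω => Q.Psi ρ₀ (R.x k ω) - Ψmin)
      (fun k ω => Q.phi (R.x k ω) ^ 2 + Q.chi A.βl (R.x k ω) ^ 2)
      (R.estimateError εf) (R.level ρ₀) (fun k => R.gradEvent κg k ∩ R.funEvent εf k) := by
  have hβl : 0 < A.βl := by linarith [A.βl_gt, A.σu_pos]
  have hγ0 : 0 < A.γ := one_pos.trans A.γ_gt
  have hαm := A.αmax_pos
  have hθ := A.θ_pos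
  have hlev : ∀ k ω, R.level ρ₀ k ω ≤ A.j₀ + k := by
    intro k ω
    induction k with
    | zero => exact le_rfl
    | succ k ih => rw [level]; split_ifs <;> omega
  have hΨc : Continuous (Q.Psi ρ₀) :=
    hΩ.smooth_f.continuous.add (continuous_const.mul hΩ.continuous_phi)
  have hφm : Measurable Q.phi := hΩ.continuous_phi.measurable
  have hχm : Measurable (Q.chi A.βl) := hΩ.measurable_chi hβl.le
  have hxm := fun k => (measurable_x_level hΩ hA hR k).1
  have hlm := fun k => (measurable_x_level hΩ hA hR k).2
  have hem : ∀ k, Measurable[R.past k]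
      fun ω => Q.phi (R.x k ω) ^ 2 + Q.chi A.βl (R.x k ω) ^ 2 := fun k =>
    ((hφm.pow_const 2).add (hχm.pow_const 2)).comp (hxm k)
  obtain ⟨Cb, hCb⟩ := hΩ.exists_stationarity_bound hKc hβl.le
  refine
    { le := R.past_le
      mono := R.past_mono
      meas_u := fun k => (hΨc.measurable.comp (hxm k)).sub_const _
      meas_e := hem
      meas_lev := hlm
      meas_A := fun k => (R.pastHalf_le k _ (measurableSet_gradEvent hΩ hA hR k)).inter
        (measurableSet_funEvent hΩ hA hR k)
      u_nonneg := fun k ω => sub_nonneg.2 (hΨ _ (hKΩ (hst.1 k ω)))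
      u_bdd := ?_
      e_nonneg := fun k ω => by positivity
      e_bdd := ⟨Cb, fun k ω => hCb _ (hst.1 k ω)⟩
      err_nonneg := estimateError_nonneg
      err_int := fun k => ?_
      lev_zero := fun ω => hm0
      good := ?_
      err_le := ?_
      step := ?_ }
  · obtain ⟨C, hC⟩ := hKc.exists_bound_of_continuousOn hΨc.continuousOn
    exact ⟨C - Ψmin, fun k ω => sub_le_sub_right ((le_abs_self _).trans (hC _ (hst.1 k ω))) _⟩
  · have hJ : MeasurableSet (R.funEvent εf k) := measurableSet_funEvent hΩ hA hR k
    exact (((hV k).2.1.integrable one_le_two).abs.indicator hJ.compl).add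
      (((hV k).1.1.integrable one_le_two).abs.indicator hJ.compl)
  · rintro k W hW hW0 ⟨C, hC⟩
    exact mul_integral_le_setIntegral_accurate hΩ hA hR hpf hpg hG hF hW hW0 hC
  · intro k B hB heB
    have hJ : MeasurableSet (R.funEvent εf k) := measurableSet_funEvent hΩ hA hR k
    have hZm : Measurable[R.pastHalf k] fun ω => R.α k ω *
        (Q.phi (R.x k ω) ^ 2 + Q.chi A.βl (R.x k ω) ^ 2) :=
      ((measurable_alpha_of_level hR (hlm k)).mul (hem k)).mono (R.past_le_pastHalf k) le_rfl
    have hZ0 : ∀ ω, 0 ≤ R.α k ω * (Q.phi (R.x k ω) ^ 2 + Q.chi A.βl (R.x k ω) ^ 2) := fun ω =>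
      mul_nonneg (alpha_pos hR k ω).le (by positivity)
    have hZC : ∀ ω, R.α k ω * (Q.phi (R.x k ω) ^ 2 + Q.chi A.βl (R.x k ω) ^ 2)
        ≤ A.αmax * Cb := fun ω =>
      mul_le_mul (alpha_le hR k ω) (hCb _ (hst.1 k ω)) (by positivity) hαm.le
    -- At a fixed time the level is at most `j₀ + k`, so the step size has a lower bound; it need
    -- not be uniform in `k`.
    have hZB : ∀ ω ∈ B, A.αmax / A.γ ^ (A.j₀ + k) * ε ≤
        R.α k ω * (Q.phi (R.x k ω) ^ 2 + Q.chi A.βl (R.x k ω) ^ 2) := by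
      intro ω hω
      refine mul_le_mul ?_ (heB ω hω) hε.le (alpha_pos hR k ω).le
      rw [alpha_eq hR]
      have := A.γ_gt.le
      have := hlev k ω
      gcongr
    have hδ : 0 < A.αmax / A.γ ^ (A.j₀ + k) * ε := by positivity
    have hB' : MeasurableSet[R.pastHalf k] B := R.past_le_pastHalf k _ hB
    have hv0 := (hV k).2
    have hvs := (hV k).1
    have e0 : ∀ ω, κf ^ 2 * R.α k ω ^ 2 * (Q.phi (R.x k ω) ^ 2 + Q.chi A.βl (R.x k ω) ^ 2) ^ 2
        = κf ^ 2 * (R.α k ω * (Q.phi (R.x k ω) ^ 2 + Q.chi A.βl (R.x k ω) ^ 2)) ^ 2 :=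
      fun ω => by ring
    simp only [e0] at hv0 hvs
    have b0 := setIntegral_compl_abs_le (R.pastHalf_le k) hB' hJ hκf hτ hδ hZm hZ0 hZC hZB
      hv0.1 (hF k) hv0.2 hτf
    have b1 := setIntegral_compl_abs_le (R.pastHalf_le k) hB' hJ hκf hτ hδ hZm hZ0 hZC hZB
      hvs.1 (hF k) hvs.2 hτf
    have i0 := (hv0.1.integrable one_le_two).abs.indicator hJ.compl
    have i1 := (hvs.1.integrable one_le_two).abs.indicator hJ.compl
    have e1 : ∫ ω in B, R.estimateError εf k ω ∂μ = _ :=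
      integral_add i0.integrableOn i1.integrableOn
    rw [e1]
    simp only [← alpha_eq hR]
    linarith
  · intro k ω
    have hα0 := alpha_pos hR k ω
    by_cases hs : ω ∈ R.successEvent ρ₀ k
    · right
      refine ⟨by rw [level, if_pos hs], ?_, ?_⟩
      · by_cases hJ : ω ∈ R.funEvent εf k
        · have h1 := Psi_succ_le_of_mem_funEvent hH hξ hεf' hR hs hJ
          have h2 : 0 ≤ A.θ * ξ / 2 * (R.α k ω * ‖R.d k ω‖ ^ 2) := by positivity
          have h3 := estimateError_nonneg (R := R) (εf := εf) k ω
          linarith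
        · have h1 := Psi_succ_le hH hR hs
          have h2 : 0 ≤ A.θ * R.α k ω * (ξ * ‖R.d k ω‖ ^ 2) := by positivity
          have hJc : ω ∈ (R.funEvent εf k)ᶜ := hJ
          simp only [estimateError, Set.indicator_of_mem hJc]
          linarith
      · rintro ⟨hI, hJ⟩
        have h1 := Psi_succ_le_of_mem_funEvent hH hξ hεf' hR hs hJ
        have h2 := hCeK k ω hI
        have h3 : A.θ * ξ / (2 * Ce) * R.α k ω *
            (Q.phi (R.x k ω) ^ 2 + Q.chi A.βl (R.x k ω) ^ 2)
            ≤ A.θ * ξ / 2 * (R.α k ω * ‖R.d k ω‖ ^ 2) := by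
          calc _ ≤ A.θ * ξ / (2 * Ce) * R.α k ω * (Ce * ‖R.d k ω‖ ^ 2) := by gcongr
            _ = _ := by field_simp
        simp only [← alpha_eq hR]
        linarith
    · left
      refine ⟨by rw [level, if_neg hs], ?_, ?_, ?_⟩
      · simp only [(step_of_notMem hR hs).1]
      · simp only [(step_of_notMem hR hs).1]
      · rintro ⟨hI, hJ⟩
        by_contra hcon
        have hle : R.α k ω ≤ A.αmax / A.γ ^ m := by
          rw [alpha_eq hR]
          have := A.γ_gt.le
          have := not_lt.1 hcon
          gcongr
        exact hs (mem_successEvent hΩ hst hH hR hρ hI hJ (hle.trans hm1)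
          ((mul_le_mul_of_nonneg_right hle hκ).trans hm))

end Run

end StochSQP

/-! ### Choice of constants and conclusion. -/

namespace StochSQP

/-- The accuracy requirements force the joint accuracy probability to be large. -/
theorem three_quarters_le_mul {γ pf pg s : ℝ} (hγ : 1 < γ) (hpf1 : pf ≤ 1) (hpg0 : 0 < pg)
    (hpg1 : pg ≤ 1) (hs : s = Real.sqrt (1 - pf))
    (hpg : (2 * γ - 1) / (2 * γ - 1 / 2 * γ⁻¹ - 1 / 2) ≤ pg)
    (hpf : 8 * (γ - 1) * s ≤ pg * (1 - γ⁻¹) * pf) : 3 / 4 ≤ pf * pg := by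
  have hγ0 : 0 < γ := by linarith
  have hi : γ⁻¹ * γ = 1 := inv_mul_cancel₀ hγ0.ne'
  have hi0 : 0 < γ⁻¹ := inv_pos.2 hγ0
  have hi1 : γ⁻¹ < 1 := inv_lt_one_of_one_lt₀ hγ
  have hs0 : 0 ≤ s := hs ▸ Real.sqrt_nonneg _
  have hs2 : s ^ 2 = 1 - pf := by rw [hs]; exact Real.sq_sqrt (by linarith)
  -- Equivalent to `4 γ² - 12 γ + 10 = (2 γ - 3)² + 1 ≥ 0`.
  have h1 : 10 / 11 ≤ pg := by
    refine le_trans ?_ hpg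
    rw [div_le_div_iff₀ (by norm_num) (by nlinarith)]
    have : 0 ≤ γ⁻¹ * (4 * γ ^ 2 - 12 * γ + 10) :=
      mul_nonneg hi0.le (by nlinarith [sq_nonneg (2 * γ - 3)])
    have e : γ⁻¹ * (4 * γ ^ 2 - 12 * γ + 10) = 4 * γ - 12 + 10 * γ⁻¹ := by
      field_simp
    linarith
  -- Cancelling `γ - 1` gives `8 γ s ≤ pg pf ≤ 1`. Hence `pf ≥ 63/64`, which with `pg ≥ 10/11` is
  -- more than enough.
  have h2 : s ≤ 1 / 8 := by
    have e : γ * (pg * (1 - γ⁻¹) * pf) = pg * pf * (γ - 1) := by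
      field_simp
    have h3 : 8 * γ * s * (γ - 1) ≤ 1 * (γ - 1) := by
      have h4 := mul_le_mul_of_nonneg_left hpf hγ0.le
      rw [e] at h4
      have h5 : pg * pf ≤ 1 := by nlinarith
      have h6 := mul_le_mul_of_nonneg_right h5 (by linarith : 0 ≤ γ - 1)
      linarith
    have h4 := le_of_mul_le_mul_right h3 (by linarith : 0 < γ - 1)
    nlinarith
  have h3 : s ^ 2 ≤ (1 / 8) ^ 2 := by gcongr
  nlinarith

end StochSQP

theorem mainTheorem3 {n m₁ m₂ : ℕ}
    (Q : StochSQP.Problem n m₁ m₂) (A : StochSQP.Params)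
    (Ω K : Set (StochSQP.E n))
    (Lf : NNReal) (Lh : Fin m₁ → NNReal) (Lc : Fin m₂ → NNReal)
    (hΩ : Q.RegularOn Ω Lf Lh Lc)
    (hK : IsClosed K) (hKΩ : K ⊆ Ω) (hMF : ∀ x ∈ K, Q.EMFCQ x)
    (ξ MH κg εf : ℝ) (hξ : 0 < ξ) (hMH : 0 < MH) (hκg : 0 < κg) (hεf : 0 < εf)
    (hεf' : εf < ξ * A.θ / (4 * A.αmax)) :
    ∃ ρstar : ℝ, 0 < ρstar ∧ ∀ ρbar : ℝ, ρstar < ρbar →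
    ∃ νstar : ℝ, 0 < νstar ∧ νstar < 1 ∧ ∀ ν : ℝ, νstar ≤ ν → ν < 1 →
    ∀ κf pf pg : ℝ, 0 < κf → 0 < pf → pf ≤ 1 → 0 < pg → pg ≤ 1 →
      (2 * A.γ - 1) / (2 * A.γ - 1 / 2 * A.γ⁻¹ - 1 / 2) ≤ pg →
      8 * ((1 - ν) * (A.γ - 1) + 2 * ν * κf) / (pg * (1 - A.γ⁻¹) * (1 - ν))
          * Real.sqrt (1 - pf) ≤ pf →
      1 / 2 ≤ pf * pg →
    ∀ (S : Type*) [MeasurableSpace S] (μ : MeasureTheory.Measure S)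
      [MeasureTheory.IsProbabilityMeasure μ]
      (x₀ : StochSQP.E n) (R : StochSQP.Run Q A x₀ ρbar pg S),
      R.Adapted → R.StaysIn K Ω → R.HessianBounds ξ MH →
      (∀ k ω, R.ζ k ω = A.ζ₀ ∧ R.pg k ω = pg) →
      R.GradAccurate μ κg → R.FunAccurate μ εf pf → R.VarianceCond μ κf →
    ∀ Ψmin : ℝ, (∀ x ∈ Ω, Ψmin ≤ Q.Psi ρbar x) →
    ∀ ε : ℝ, 0 < ε →
      ∫⁻ ω, R.hitTime ε ω ∂μ ≤
        ENNReal.ofReal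
          (1 / (2 * pf * pg - 1)
            * (4 * (κg * A.βu + 1 / 2 * Lf + 2 * εf + 1 / 2 * ρbar * StochSQP.Lhc Lh Lc)
                / ((1 - ν) * (1 - A.γ⁻¹) * (1 - A.θ) * ξ * ε))
            * StochSQP.merit₀ Q A x₀ ρbar ν Ψmin + 1) := by
  have hθ0 := A.θ_pos
  have hθ1 := A.θ_lt
  have hγ := A.γ_gt
  have hγ0 : 0 < A.γ := one_pos.trans hγ
  have hαm := A.αmax_pos
  have hβu : 0 < A.βu := by linarith [A.βl_gt, A.σu_pos, A.βu_gt]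
  have hL0 : 0 ≤ StochSQP.Lhc Lh Lc := NNReal.coe_nonneg _
  have hγi0 : 0 < A.γ⁻¹ := inv_pos.2 hγ0
  have hγi1 : A.γ⁻¹ < 1 := inv_lt_one_of_one_lt₀ hγ
  have hKc : IsCompact K := hΩ.isCompact.of_isClosed_subset hK hKΩ
  obtain ⟨ρs, hρs, hpen⟩ := hΩ.exists_penalty A hKc hMF hMH
  obtain ⟨Ce, hCe, hCeK⟩ := hΩ.exists_sq_add_sq_le A hKc hMF hξ hMH hκg
  refine ⟨ρs, hρs, fun ρbar hρbar => ?_⟩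
  have hρ0 : 0 < ρbar := hρs.trans hρbar
  set M : ℝ := κg + Lf + 2 * εf + ρbar * StochSQP.Lhc Lh Lc with hMdef
  have hM : 0 < M := by positivity
  -- The critical level: from here on the step sizes are at most one and small enough for accurate
  -- iterations to succeed.
  obtain ⟨m, hm0, hm1, hm⟩ : ∃ m : ℕ, A.j₀ ≤ m ∧ A.αmax / A.γ ^ m ≤ 1 ∧
      A.αmax / A.γ ^ m * M ≤ (1 - A.θ) * ξ := by
    have ht : Filter.Tendsto (fun m : ℕ => A.αmax / A.γ ^ m) Filter.atTop (nhds 0) :=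
      Filter.Tendsto.div_atTop tendsto_const_nhds (tendsto_pow_atTop_atTop_of_one_lt hγ)
    have hδ : 0 < min 1 ((1 - A.θ) * ξ / M) :=
      lt_min one_pos (div_pos (mul_pos (by linarith) hξ) hM)
    obtain ⟨m, hm, hj⟩ := ((ht.eventually (Iic_mem_nhds hδ)).and
      (Filter.eventually_ge_atTop A.j₀)).exists
    have hm' : A.αmax / A.γ ^ m ≤ min 1 ((1 - A.θ) * ξ / M) := hm
    exact ⟨m, hj, hm'.trans (min_le_left _ _), (le_div_iff₀ hM).1 (hm'.trans (min_le_right _ _))⟩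
  set c : ℝ := A.θ * ξ / (2 * Ce) with hc
  have hc0 : 0 < c := by positivity
  set v : ℝ := c * (A.αmax / A.γ ^ m) / 4 ^ (m + 1) with hv
  have hv0 : 0 < v := by positivity
  set N : ℝ := κg * A.βu + 1 / 2 * Lf + 2 * εf + 1 / 2 * ρbar * StochSQP.Lhc Lh Lc with hN
  have hN0 : 0 < N := by positivity
  have hgθ : 0 < (1 - A.γ⁻¹) * (1 - A.θ) * ξ :=
    mul_pos (mul_pos (by linarith) (by linarith)) hξ
  -- With `r (1 - ν) ≤ ν`, the first summand makes the asserted bound exceed the one proved, and the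
  -- second makes the estimation error small against `v`.
  set r : ℝ := (1 - A.γ⁻¹) * (1 - A.θ) * ξ / (2 * N * v) + A.αmax / (4 * v) with hr
  have hr0 : 0 < r := by positivity
  refine ⟨r / (1 + r), by positivity, (div_lt_one (by positivity)).2 (by linarith), ?_⟩
  intro ν hν hν1 κf pf pg hκf hpf0 hpf1 hpg0 hpg1 hpgc hpfc _ S _ μ _ x₀ R hA hst hH hζ hG hF hV
    Ψmin hΨ ε hε
  have hν1' : 0 < 1 - ν := by linarith
  have hν0 : 0 < ν := lt_of_lt_of_le (by positivity) hν
  have hrν : r * (1 - ν) ≤ ν := by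
    rw [div_le_iff₀ (by positivity)] at hν
    linarith
  set s : ℝ := Real.sqrt (1 - pf) with hs
  have hs0 : 0 ≤ s := Real.sqrt_nonneg _
  have hs2 : s ^ 2 = 1 - pf := Real.sq_sqrt (by linarith)
  have hpfc' : 8 * ((1 - ν) * (A.γ - 1) + 2 * ν * κf) * s ≤ pf * (pg * (1 - A.γ⁻¹) * (1 - ν)) := by
    rw [div_mul_eq_mul_div, div_le_iff₀ (mul_pos (mul_pos hpg0 (by linarith)) hν1')] at hpfc
    exact hpfc
  have hp : 3 / 4 ≤ pf * pg := by
    refine StochSQP.three_quarters_le_mul hγ hpf1 hpg0 hpg1 hs hpgc ?_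
    have h1 : 0 ≤ 8 * (2 * ν * κf) * s := by positivity
    have h2 : 8 * (A.γ - 1) * s * (1 - ν) ≤ pg * (1 - A.γ⁻¹) * pf * (1 - ν) := by linarith
    exact le_of_mul_le_mul_right h2 hν1'
  -- Chosen so that `4 τ` times the largest step size is exactly `v`, the admissible error in the
  -- drift bound.
  set τ : ℝ := v / (4 * A.αmax) with hτ
  have hτ0 : 0 < τ := by positivity
  have hκs : κf * s ≤ τ := by
    have h1 : 0 ≤ 8 * ((1 - ν) * (A.γ - 1)) * s := by
      have : 0 ≤ A.γ - 1 := by linarith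
      positivity
    have h2 : pf * (pg * (1 - A.γ⁻¹) * (1 - ν)) ≤ 1 * (1 - ν) := by
      rw [← mul_assoc]
      refine mul_le_mul_of_nonneg_right ?_ hν1'.le
      exact mul_le_one₀ hpf1 (mul_nonneg hpg0.le (by linarith))
        (mul_le_one₀ hpg1 (by linarith) (by linarith))
    have h3 : 16 * r * (κf * s) * (1 - ν) ≤ 1 * (1 - ν) := by
      have := mul_le_mul_of_nonneg_right hrν (by positivity : 0 ≤ 16 * (κf * s))
      linarith
    have h4 := le_of_mul_le_mul_right h3 hν1'
    have h5 : A.αmax / (4 * v) ≤ r := by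
      rw [hr]
      have : 0 ≤ (1 - A.γ⁻¹) * (1 - A.θ) * ξ / (2 * N * v) := by positivity
      linarith
    have h6 : A.αmax / (4 * v) * (16 * (κf * s)) ≤ 1 := by
      have := mul_le_mul_of_nonneg_right h5 (by positivity : 0 ≤ 16 * (κf * s))
      linarith
    rw [hτ, le_div_iff₀ (by positivity)]
    rw [div_mul_eq_mul_div, div_le_one (by positivity)] at h6
    linarith
  have hτf : κf ^ 2 * (1 - pf) ≤ τ ^ 2 := by
    rw [← hs2, ← mul_pow]
    gcongr
  have hR : R.ReductionBound := fun k ω =>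
    hpen (R.x k ω) (hst.1 k ω) (R.g k ω) (R.d k ω) (R.H k ω) (R.β k ω) ρbar
      (R.norm_g_le (fun k ω => (hζ k ω).1) k ω) (fun v => (hH k ω v).2) (R.β_mem k ω).1
      (R.d_min k ω) hρbar.le
  have hP := StochSQP.Run.levelProcess (μ := μ) hΩ hKc hKΩ hξ hεf' hρ0.le hCe
    (fun k ω hω => hCeK (R.x k ω) (hst.1 k ω) (R.g k ω) (R.d k ω) (R.H k ω) (R.β k ω) (R.α k ω)
      (hH k ω) (R.β_mem k ω) (R.d_mem k ω) (R.d_min k ω) (StochSQP.Run.alpha_le hR k ω) hω)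
    hm0 hm1 hM.le hm hA hst hH hR hκf hτ0 hpf0.le hτf (fun k ω => (hζ k ω).2) hG hF hV hΨ hε
  have hanti : Antitone fun i : ℕ => A.αmax / A.γ ^ i := by
    intro i j hij
    have := hγ.le
    show A.αmax / A.γ ^ j ≤ A.αmax / A.γ ^ i
    gcongr
  have hbound := hP.lintegral_hit_le hanti (fun i => by positivity) hc0 hp hε hv
    (by positivity) (by
      rw [pow_zero, div_one, hτ]
      exact le_of_eq (by field_simp)) (fun ω => by rw [R.x_zero])
  refine le_trans hbound (ENNReal.ofReal_le_ofReal ?_)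
  obtain ⟨ω₀⟩ : Nonempty S := μ.nonempty_of_neZero
  have hx₀ : x₀ ∈ Ω := by
    have := hKΩ (hst.1 0 ω₀)
    rwa [R.x_zero] at this
  set U : ℝ := Q.Psi ρbar x₀ - Ψmin with hU
  have hU0 : 0 ≤ U := sub_nonneg.2 (hΨ x₀ hx₀)
  -- Only the `Ψ` part of the initial merit value is needed; its other part, like the final `+ 1`,
  -- is slack.
  have hmer : ν * U ≤ StochSQP.merit₀ Q A x₀ ρbar ν Ψmin := by
    have hα₀ : 0 < A.α₀ := div_pos hαm (pow_pos hγ0 _)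
    have : 0 ≤ (1 - ν) * A.α₀ * (Q.phi x₀ ^ 2 + Q.chi A.βl x₀ ^ 2) := by positivity
    unfold StochSQP.merit₀
    linarith
  set D : ℝ := (1 - ν) * (1 - A.γ⁻¹) * (1 - A.θ) * ξ * ε with hD
  have hD0 : 0 < D := by
    have := mul_pos (mul_pos hν1' hgθ) hε
    rw [hD]; linarith
  have hq : 1 ≤ 1 / (2 * pf * pg - 1) := by
    have h1 : pf * pg ≤ 1 := mul_le_one₀ hpf1 hpg0.le hpg1
    rw [le_div_iff₀ (by linarith)]
    linarith
  have h1 : 2 * U / (v * ε) ≤ 4 * N / D * (ν * U) := by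
    have h2 : (1 - A.γ⁻¹) * (1 - A.θ) * ξ / (2 * N * v) ≤ r := by
      rw [hr]
      have : 0 ≤ A.αmax / (4 * v) := by positivity
      linarith
    have h3 : (1 - A.γ⁻¹) * (1 - A.θ) * ξ * (1 - ν) ≤ 2 * N * v * ν := by
      rw [div_le_iff₀ (by positivity)] at h2
      have h4 := mul_le_mul_of_nonneg_right h2 hν1'.le
      have h5 := mul_le_mul_of_nonneg_right hrν (by positivity : 0 ≤ 2 * N * v)
      linarith
    have h6 : D ≤ 2 * N * v * ν * ε := by
      have := mul_le_mul_of_nonneg_right h3 hε.le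
      rw [hD]; linarith
    rw [div_mul_eq_mul_div (4 * N), div_le_div_iff₀ (by positivity) hD0]
    have := mul_le_mul_of_nonneg_left h6 (by positivity : 0 ≤ 2 * U)
    linarith
  have h2 : 4 * N / D * (ν * U) ≤ 4 * N / D * StochSQP.merit₀ Q A x₀ ρbar ν Ψmin := by gcongr
  have h3 : 0 ≤ 4 * N / D * StochSQP.merit₀ Q A x₀ ρbar ν Ψmin :=
    le_trans (by positivity) h2
  have h4 := mul_le_mul_of_nonneg_right hq h3
  linarith
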